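/- Let $V$ be a finite set and $f$ an edge-coloring of the complete graph on $V$. For $S\subseteq V$ let $f(S)$ be the set of colors of the edges inside $S$. A set $S\subseteq V$ has a leftover structure under $f$ if either $|S|=1$, or $S$ is the disjoint union of nonempty sets $A$ and $B$ that each have a leftover structure under $f$, such that $f(A)\cap f(B)=\emptyset$ and, for some color $\alpha\notin f(A)\cup f(B)$, $f(ab)=\alpha$ for all $a\in A$ and $b\in B$. **The coloring $\psi_q$.** Let $q\ge 1$, and let $r_1\mid r_2\mid\dots\mid r_q$ be positive integers and $m\ge r_q$ an integer; put $r_0=1$ and $r_{q+1}=m$. For a positive integer $r$, a binary string is cut into consecutive $r$-blocks, that is, blocks of length $r$, except that the last one may be shorter. For strings $x,y$ of equal length let $\eta_d(x,y)=0$ if $x=y$, and otherwise $\eta_d(x,y)=(i,\{u,v\})$, where $i$ is the least index for which the $i$-th $r_d$-blocks $u$ of $x$ and $v$ of $y$ differ. For distinct $x,y\in\{0,1\}^m$ let $\xi_d(x,y)$ be the sequence of the values of $\eta_d$ on the pairs of corresponding $r_{d+1}$-blocks of $x$ and $y$, and let $c_q(x,y)=(\xi_q(x,y),\dots,\xi_0(x,y))$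 (the modified Conlon–Fox–Lee–Sudakov coloring). With strings ordered lexicographically, for $x<y$ let $\Delta_q(x,y)=\Delta_q(y,x)$ be the sequence with one entry for each $r_q$-block, the $i$-th entry being $+1$ if the $i$-th $r_q$-block of $x$ is at most that of $y$, and $-1$ otherwise. Let $\psi_q=c_q\times\Delta_q$, that is, $\psi_q(x,y)=(c_q(x,y),\Delta_q(x,y))$; it is an edge-coloring of the complete graph on $\{0,1\}^m$. **Theorem.** Let $p\ge 3$ and $q=\max(p-3,1)$. For each $n$ let $\beta$ be the least positive integer with $n\le 2^{\beta^{q+1}}$. There are edge-colorings $f_n$ of $K_n$ $(n=0,1,2,\dots)$, each obtained from the coloring $\psi_q$ with $m=\beta^{q+1}$ and $r_d=\beta^d$ $(1\le d\le q)$ by identifying the vertices of $K_n$ with distinct strings in $\{0,1\}^{m}$, such that 1. $f_n$ uses at most $n^{o(1)}$ colors as $n\to\infty$, for $p$ fixed; 2. for every $n$, every $p$-clique of $K_n$ contains edges of at least $p-1$ distinct colors under $f_n$; 3. for every $n$, a $p$-clique of $K_n$ contains exactly $p-1$ distinct colors under $f_n$ if and only if it has a leftover structure under $f_n$. -/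

import Mathlib

namespace ErdosGyarfas

open SimpleGraph

/-! ### Edge-colorings of complete graphs -/

section Colorings

variable {V C : Type*}

/-- The set `f(S)` of colors that the edge-coloring `f` gives to the edges inside `S`. -/
def colorsOn (f : TopEdgeLabeling V C) (S : Finset V) : Set C :=
  {c | ∃ x ∈ S, ∃ y ∈ S, ∃ h : x ≠ y, f.get x y h = c}

/-- The number of colors that the edge-coloring `f` uses. -/
noncomputable def numColors (f : TopEdgeLabeling V C) : ℕ :=
  (Set.range f).ncard

/-- `f` is a `(p, q)`-coloring: every `p`-clique contains edges of at least `q` distinct colors. -/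
def IsPQColoring (f : TopEdgeLabeling V C) (p q : ℕ) : Prop :=
  ∀ S : Finset V, S.card = p → q ≤ (colorsOn f S).ncard

/-- `S` has a leftover structure under `f`: either `S` is a single vertex, or `S` is the union of
disjoint nonempty sets `A` and `B`, each with a leftover structure, with no color in common, such
that all edges between `A` and `B` have one color `α`, which occurs neither in `A` nor in `B`. -/
inductive HasLeftover [DecidableEq V] (f : TopEdgeLabeling V C) : Finset V → Prop
  | single (v : V) : HasLeftover f {v}
  | join (A B : Finset V) (α : C)
      (hAne : A.Nonempty) (hBne : B.Nonempty) (hdisj : Disjoint A B)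
      (hA : HasLeftover f A) (hB : HasLeftover f B)
      (hcolors : Disjoint (colorsOn f A) (colorsOn f B))
      (hcross : ∀ a ∈ A, ∀ b ∈ B, ∀ h : a ≠ b, f.get a b h = α)
      (hαA : α ∉ colorsOn f A) (hαB : α ∉ colorsOn f B) :
      HasLeftover f (A ∪ B)

end Colorings

/-! ### The coloring `ψ = c × Δ` of the complete graph on binary strings

Binary strings are lists of Booleans with `false < true`. Blocks are numbered from `0`. -/

/-- The `i`-th block of `x`, when `x` is cut into consecutive blocks of length `r`
(the last block may be shorter). -/
def block (r : ℕ) (x : List Bool) (i : ℕ) : List Bool :=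
  (x.drop (i * r)).take r

/-- The number of blocks, `⌈m / r⌉`, into which a string of length `m` is cut. -/
def numBlocks (r m : ℕ) : ℕ := m ⌈/⌉ r

/-- `η` at block length `r`: the first block in which `x` and `y` differ, together with the
unordered pair of these blocks; `none` stands for the value `0` at `x = y`. -/
noncomputable def eta (r : ℕ) (x y : List Bool) : Option (ℕ × Sym2 (List Bool)) :=
  if x = y then none
  else
    let i := sInf {i : ℕ | block r x i ≠ block r y i}
    some (i, s(block r x i, block r y i))

/-- The block lengths `r_0 = 1`, `r_1, …, r_q`, `r_{q+1} = m` for strings of length `m`. -/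
def blockLength (q : ℕ) (r : ℕ → ℕ) (m d : ℕ) : ℕ :=
  if d = 0 then 1 else if d ≤ q then r d else m

/-- `ξ_d`: apply `η_d` to each pair of corresponding `r_{d+1}`-blocks of `x` and `y`. -/
noncomputable def xi (q : ℕ) (r : ℕ → ℕ) (d : ℕ) (x y : List Bool) :
    List (Option (ℕ × Sym2 (List Bool))) :=
  (List.range (numBlocks (blockLength q r x.length (d + 1)) x.length)).map fun i =>
    eta (blockLength q r x.length d)
      (block (blockLength q r x.length (d + 1)) x i)
      (block (blockLength q r x.length (d + 1)) y i)

/-- The modified Conlon–Fox–Lee–Sudakov coloring `c_q = (ξ_d)_{0 ≤ d ≤ q}`. -/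
noncomputable def cfls (q : ℕ) (r : ℕ → ℕ) (x y : List Bool) :
    Fin (q + 1) → List (Option (ℕ × Sym2 (List Bool))) :=
  fun d => xi q r d x y

/-- The signs `δ_{q,i}` for `x < y`: `1` if the `i`-th `r_q`-block of `x` is lexicographically at
most that of `y`, and `-1` otherwise. -/
def blockSign (q : ℕ) (r : ℕ → ℕ) (i : ℕ) (x y : List Bool) : ℤ :=
  if block (r q) x i ≤ block (r q) y i then 1 else -1

/-- `Δ_q`: the list of the signs `δ_{q,i}` over all `r_q`-blocks, where the two strings are first
put in lexicographic order. -/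
def signs (q : ℕ) (r : ℕ → ℕ) (x y : List Bool) : List ℤ :=
  (List.range (numBlocks (r q) x.length)).map fun i =>
    blockSign q r i (min x y) (max x y)

/-- The type in which `ψ_q` takes its values. -/
abbrev PsiColor (q : ℕ) : Type :=
  (Fin (q + 1) → List (Option (ℕ × Sym2 (List Bool)))) × List ℤ

/-- `ψ_q(x, y) = (c_q(x, y), Δ_q(x, y))`. -/
noncomputable def psiFun (q : ℕ) (r : ℕ → ℕ) (x y : List Bool) : PsiColor q :=
  (cfls q r x y, signs q r x y)

theorem eta_comm (r : ℕ) (x y : List Bool) : eta r y x = eta r x y := by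
  unfold eta
  by_cases h : x = y
  · simp [h]
  · have hs : {i : ℕ | block r y i ≠ block r x i} = {i : ℕ | block r x i ≠ block r y i} := by
      ext i
      exact ne_comm
    simp only [h, Ne.symm h, if_false, hs, Sym2.eq_swap]

theorem psiFun_comm (q : ℕ) (r : ℕ → ℕ) {x y : List Bool} (h : x.length = y.length) :
    psiFun q r y x = psiFun q r x y := by
  unfold psiFun cfls xi signs
  simp only [h, eta_comm _ (block _ x _), min_comm y x, max_comm y x]

/-- The edge-coloring `ψ_q` of the complete graph with vertex set `{0,1}^m`, for the parameters
`r_1, …, r_q`. -/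
noncomputable def psi (q : ℕ) (r : ℕ → ℕ) (m : ℕ) :
    TopEdgeLabeling (List.Vector Bool m) (PsiColor q) :=
  EdgeLabeling.mk (fun x y _ => psiFun q r x.toList y.toList)
    (fun x y _ => psiFun_comm q r (by simp))

/-- The least positive integer `β` with `n ≤ 2 ^ (β ^ (q + 1))`. -/
noncomputable def base (q n : ℕ) : ℕ :=
  sInf {β : ℕ | 0 < β ∧ n ≤ 2 ^ (β ^ (q + 1))}

/-- The coloring `ψ_q` that is used for `K_n`: the vertices are the binary strings of length
`β ^ (q + 1)` and the block lengths are `r_d = β ^ d`, where `β = base q n`. -/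
noncomputable def psiFor (q n : ℕ) :
    TopEdgeLabeling (List.Vector Bool (base q n ^ (q + 1))) (PsiColor q) :=
  psi q (fun d => base q n ^ d) (base q n ^ (q + 1))

end ErdosGyarfas

/-!
Vertices are binary strings, cut into `r_q`-blocks. Everything reduces to one assertion: a set `S`
of at most `q + 3` strings with fewer than `|S|` colors under `ψ_q` has a leftover structure. The
rest is the easy count `HasLeftover.card_palette` and the estimate of the number of colors.

It is convenient to count a color for the diagonal as well, so that `|S| - 1` colors become `|S|`
values (`palette`). A coloring is `Expanding` if each set of `n` points sees at least `n` values, and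
`StablyExpanding` if its product with any expanding coloring is expanding. Stable expansion passes
to refinements and products, and it survives the addition of a twin joined to the old point by an
edge of a new color (`StablyExpanding.insert_twin`). Hence it also survives replacing points by
cliques whose edges all get colors of their own (`stablyExpanding_blowUp`).

This gives the lower bound of Conlon, Fox, Lee and Sudakov: `c_d` is stably expanding on sets of at
most `d + 3` strings (`stablyExpanding_towerColor`). Pass from prefixes of `k` blocks to prefixes of
`k + 1` blocks. If block `k` takes at most `d + 2` values, `c_d` refines the product of `c_d` on the
prefixes and `c_{d-1}` on block `k`. If it takes more, it separates all points, so the edges between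
points with a common prefix have colors of their own, and `c_d` refines a blow-up. The latter also
holds for `d = 0`, as two disjoint pairs with common prefixes need four strings.

For the leftover structure, let `S` have fewer than `|S|` colors and let block `k` be the last one
that is needed to separate `S`. If two different pairs with common prefixes had the same color, the
product coloring would account for all colors of `S`. But it does not see the signs, and these
separate the two diagonals of the rectangle spanned by the pairs (`blockSign_ne`). So the edges
inside a prefix class have colors of their own, the coloring refines the blow-up, and by counting
it equals the blow-up. Then two points with the same prefix are twins; removing one of them leaves a
set with a leftover structure by induction, and doubling a vertex keeps such a structure
(`HasLeftover.insert_twin`).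

The number of colors is at most `2 ^ O(β ^ q log β)`, while `n > 2 ^ ((β - 1) ^ (q + 1))`. Bounding
`log β` by a multiple of `√β` suffices for `n ^ o(1)`.
-/

namespace ErdosGyarfas

/-! ### Colorings with many colors on every set -/

section Expanding

variable {V T X C D E : Type}

open Classical in
/-- The values of `F` on the pairs from `S`, the diagonal included. When `F` is an edge-coloring
with one extra value on the diagonal, this has one element more than the set of colors in `S`. -/
noncomputable def palette (F : V → V → C) (S : Finset V) : Finset C :=
  Finset.image₂ F S S

theorem mem_palette {F : V → V → C} {S : Finset V} {c : C} :
    c ∈ palette F S ↔ ∃ x ∈ S, ∃ y ∈ S, F x y = c := by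
  simp [palette, Finset.mem_image₂]

theorem mem_palette_of_mem (F : V → V → C) {S : Finset V} {x y : V} (hx : x ∈ S) (hy : y ∈ S) :
    F x y ∈ palette F S :=
  mem_palette.2 ⟨x, hx, y, hy, rfl⟩

theorem palette_mono (F : V → V → C) {S S' : Finset V} (h : S ⊆ S') :
    palette F S ⊆ palette F S' := by
  intro c hc
  obtain ⟨x, hx, y, hy, rfl⟩ := mem_palette.1 hc
  exact mem_palette_of_mem F (h hx) (h hy)

/-- On pairs from `A`, the color under `F` determines the color under `H`. -/
def Refines (F : V → V → C) (H : V → V → D) (A : Set V) : Prop :=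
  ∀ ⦃x⦄, x ∈ A → ∀ ⦃y⦄, y ∈ A → ∀ ⦃x'⦄, x' ∈ A → ∀ ⦃y'⦄, y' ∈ A →
    F x y = F x' y' → H x y = H x' y'

theorem Refines.exists_factor {F : V → V → C} {H : V → V → D} {S : Finset V}
    (h : Refines F H S) (hS : S.Nonempty) :
    ∃ φ : C → D, ∀ x ∈ S, ∀ y ∈ S, φ (F x y) = H x y := by
  classical
  obtain ⟨v, -⟩ := hS
  refine ⟨fun c => if hc : ∃ x ∈ S, ∃ y ∈ S, F x y = c then H hc.choose hc.choose_spec.2.choose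
    else H v v, fun x hx y hy => ?_⟩
  have hc : ∃ x' ∈ S, ∃ y' ∈ S, F x' y' = F x y := ⟨x, hx, y, hy, rfl⟩
  simp only [dif_pos hc]
  exact h hc.choose_spec.1 hc.choose_spec.2.choose_spec.1 hx hy hc.choose_spec.2.choose_spec.2

theorem palette_eq_image [DecidableEq D] {F : V → V → C} {H : V → V → D} {S : Finset V} {φ : C → D}
    (hφ : ∀ x ∈ S, ∀ y ∈ S, φ (F x y) = H x y) : palette H S = (palette F S).image φ := by
  ext d
  simp only [Finset.mem_image, mem_palette]
  constructor
  · rintro ⟨x, hx, y, hy, rfl⟩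
    exact ⟨_, ⟨x, hx, y, hy, rfl⟩, hφ x hx y hy⟩
  · rintro ⟨_, ⟨x, hx, y, hy, rfl⟩, rfl⟩
    exact ⟨x, hx, y, hy, (hφ x hx y hy).symm⟩

theorem Refines.card_palette_le {F : V → V → C} {H : V → V → D} {S : Finset V}
    (h : Refines F H S) : (palette H S).card ≤ (palette F S).card := by
  classical
  obtain rfl | hS := S.eq_empty_or_nonempty
  · simp [palette]
  obtain ⟨φ, hφ⟩ := h.exists_factor hS
  rw [palette_eq_image hφ]
  exact Finset.card_image_le

/-- A refinement that does not have more colors is the same coloring. -/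
theorem Refines.symm_of_card_le {F : V → V → C} {H : V → V → D} {S : Finset V}
    (h : Refines F H S) (hc : (palette F S).card ≤ (palette H S).card) : Refines H F S := by
  classical
  intro x hx y hy x' hx' y' hy' he
  obtain ⟨φ, hφ⟩ := h.exists_factor ⟨x, hx⟩
  rw [palette_eq_image hφ] at hc
  have hinj := Finset.injOn_of_card_image_eq (le_antisymm Finset.card_image_le hc)
  refine hinj (mem_palette_of_mem F hx hy) (mem_palette_of_mem F hx' hy') ?_
  rw [hφ x hx y hy, hφ x' hx' y' hy', he]

theorem palette_image [DecidableEq T] (H : T → T → D) (g : V → T) (S : Finset V) :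
    palette H (S.image g) = palette (fun x y => H (g x) (g y)) S := by
  ext d
  simp [mem_palette]

/-- Every finite set of `n` points in `A` sees at least `n` values of `F`, the diagonal
included. -/
def Expanding (F : V → V → C) (A : Set V) : Prop :=
  ∀ U : Finset V, (U : Set V) ⊆ A → U.card ≤ (palette F U).card

theorem Expanding.of_refines {F : V → V → C} {H : T → T → D} {A : Set V} {B : Set T}
    (hH : Expanding H B) (g : V → T) (hg : Set.InjOn g A) (hAB : Set.MapsTo g A B)
    (h : Refines F (fun x y => H (g x) (g y)) A) : Expanding F A := by
  classical
  intro U hU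
  have h1 := hH (U.image g) (by
    intro t ht
    obtain ⟨x, hx, rfl⟩ := Finset.mem_image.1 (Finset.mem_coe.1 ht)
    exact hAB (hU hx))
  rw [Finset.card_image_of_injOn (hg.mono hU), palette_image] at h1
  refine h1.trans (Refines.card_palette_le ?_)
  exact fun x hx y hy x' hx' y' hy' => h (hU hx) (hU hy) (hU hx') (hU hy')

/-- The product of two colorings. -/
def tensor (K : X → X → D) (L : T → T → C) (p q : X × T) : D × C :=
  (K p.1 q.1, L p.2 q.2)

/-- `L` is stably expanding on `S` if its product with every expanding coloring is expanding. In
contrast to `Expanding`, this is visibly closed under products. -/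
def StablyExpanding (L : T → T → C) (S : Set T) : Prop :=
  ∀ ⦃X D : Type⦄ (K : X → X → D) (A : Set X), Expanding K A → Expanding (tensor K L) (A ×ˢ S)

theorem StablyExpanding.expanding {L : T → T → C} {S : Set T} (hL : StablyExpanding L S) :
    Expanding L S := by
  have h : Expanding (fun _ _ : Unit => ()) Set.univ := by
    intro U _
    obtain rfl | ⟨u, hu⟩ := U.eq_empty_or_nonempty
    · simp
    · exact (Finset.card_le_one_of_subsingleton U).trans
        (Finset.card_pos.2 ⟨_, mem_palette_of_mem _ hu hu⟩)
  refine (hL _ _ h).of_refines (fun t => ((), t)) (fun a _ b _ hab => congrArg Prod.snd hab)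
    (fun a ha => ⟨trivial, ha⟩) ?_
  intro x _ y _ x' _ y' _ h
  simp [tensor, h]

theorem StablyExpanding.of_refines {F : V → V → C} {L : T → T → E} {A : Set V} {B : Set T}
    (hL : StablyExpanding L B) (g : V → T) (hg : Set.InjOn g A) (hAB : Set.MapsTo g A B)
    (h : Refines F (fun x y => L (g x) (g y)) A) : StablyExpanding F A := by
  intro X D K Z hK
  refine (hL K Z hK).of_refines (Prod.map id g) ?_ ?_ ?_
  · rintro ⟨p, a⟩ ⟨_, ha⟩ ⟨q, b⟩ ⟨_, hb⟩ hab
    simp only [Prod.map_apply, id_eq, Prod.mk.injEq] at hab ⊢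
    exact ⟨hab.1, hg ha hb hab.2⟩
  · rintro ⟨p, a⟩ ⟨hp, ha⟩
    exact ⟨hp, hAB ha⟩
  · rintro ⟨_, x⟩ ⟨_, hx⟩ ⟨_, y⟩ ⟨_, hy⟩ ⟨_, x'⟩ ⟨_, hx'⟩ ⟨_, y'⟩ ⟨_, hy'⟩ he
    simp only [tensor, Prod.mk.injEq, Prod.map_apply, id_eq] at he ⊢
    exact ⟨he.1, h hx hy hx' hy' he.2⟩

theorem StablyExpanding.mono {L : T → T → C} {A B : Set T} (hL : StablyExpanding L B)
    (h : A ⊆ B) : StablyExpanding L A :=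
  hL.of_refines id (Set.injOn_id _) h fun _ _ _ _ _ _ _ _ he => he

theorem StablyExpanding.prod {L : T → T → C} {M : V → V → E} {A : Set T} {B : Set V}
    (hL : StablyExpanding L A) (hM : StablyExpanding M B) :
    StablyExpanding (tensor L M) (A ×ˢ B) := by
  intro X D K Z hK
  refine (hM _ _ (hL K Z hK)).of_refines (fun p => ((p.1, p.2.1), p.2.2)) ?_ ?_ ?_
  · rintro ⟨a, b, c⟩ _ ⟨a', b', c'⟩ _ h
    simpa [and_assoc] using h
  · rintro ⟨a, b, c⟩ ⟨ha, hb, hc⟩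
    exact ⟨⟨ha, hb⟩, hc⟩
  · rintro x _ y _ x' _ y' _ h
    simp only [tensor, Prod.mk.injEq] at h ⊢
    exact ⟨⟨h.1, h.2.1⟩, h.2.2⟩

theorem StablyExpanding.of_subsingleton (L : T → T → C) {S : Set T} (hS : S.Subsingleton) :
    StablyExpanding L S := by
  intro X D K A hK
  refine hK.of_refines Prod.fst ?_ (fun p hp => hp.1) ?_
  · rintro ⟨a, b⟩ ⟨_, hb⟩ ⟨a', b'⟩ ⟨_, hb'⟩ h
    exact Prod.ext h (hS hb hb')
  · intro x _ y _ x' _ y' _ h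
    exact congrArg Prod.fst h

/-- Adding a twin `x` of a point `y ∈ S`, where the color of the edge `xy` does not occur in `S`,
preserves stable expansion. Merging the columns of `x` and `y` in a set `W ⊆ X × T` loses as many
points as there are rows that meet both columns; the color of `xy`, paired with the colors of `K`,
makes up for these and for the pairs that only the merged column contains. -/
theorem StablyExpanding.insert_twin {L : T → T → C} {S : Set T} {x y : T}
    (hL : StablyExpanding L S) (hy : y ∈ S) (hx : x ∉ S) (hdiag : L x x = L y y)
    (hsymm : L y x = L x y) (htwin : ∀ z ∈ S, z ≠ y → L x z = L y z ∧ L z x = L z y)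
    (hnew : ∀ a ∈ S, ∀ b ∈ S, L a b ≠ L x y) : StablyExpanding L (insert x S) := by
  classical
  intro X D K A hK W hW
  have hxy : x ≠ y := fun h => hx (h ▸ hy)
  let μ : T → T := fun t => if t = x then y else t
  have hμx : μ x = y := if_pos rfl
  have hμ : ∀ t, t ≠ x → μ t = t := fun t ht => if_neg ht
  have hμS : ∀ t ∈ insert x S, μ t ∈ S := by
    intro t ht
    by_cases h : t = x
    · rw [h, hμx]; exact hy
    · rw [hμ t h]; exact (Set.mem_insert_iff.1 ht).resolve_left h
  let W' := W.image (Prod.map id μ)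
  -- the rows that meet both columns
  let I := (W.filter fun p => p.2 = x ∧ (p.1, y) ∈ W).image Prod.fst
  have hI : ∀ P ∈ I, (P, x) ∈ W ∧ (P, y) ∈ W := by
    intro P hP
    obtain ⟨⟨P', t⟩, hp, rfl⟩ := Finset.mem_image.1 hP
    obtain ⟨h1, h2, h3⟩ := Finset.mem_filter.1 hp
    simp only at h2 h3 ⊢
    exact ⟨h2 ▸ h1, h3⟩
  have hcard : W.card ≤ W'.card + I.card := by
    have h1 := Finset.card_filter_add_card_filter_not (s := W) fun p => p.2 = x ∧ (p.1, y) ∈ W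
    have h2 : (W.filter fun p => p.2 = x ∧ (p.1, y) ∈ W).card = I.card := by
      refine (Finset.card_image_of_injOn ?_).symm
      rintro ⟨P, t⟩ hp ⟨Q, s⟩ hq h
      have hp2 := (Finset.mem_filter.1 (Finset.mem_coe.1 hp)).2.1
      have hq2 := (Finset.mem_filter.1 (Finset.mem_coe.1 hq)).2.1
      exact Prod.ext h (hp2.trans hq2.symm)
    have h3 : (W.filter fun p => ¬(p.2 = x ∧ (p.1, y) ∈ W)).card ≤ W'.card := by
      refine Finset.card_le_card_of_injOn (Prod.map id μ) ?_ ?_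
      · intro p hp
        exact Finset.mem_image_of_mem _ (Finset.mem_filter.1 (Finset.mem_coe.1 hp)).1
      · rintro ⟨P, t⟩ hp ⟨Q, s⟩ hq h
        obtain ⟨hp1, hp2⟩ := Finset.mem_filter.1 (Finset.mem_coe.1 hp)
        obtain ⟨hq1, hq2⟩ := Finset.mem_filter.1 (Finset.mem_coe.1 hq)
        simp only [Prod.map_apply, id_eq, Prod.mk.injEq] at h hp2 hq2 ⊢
        obtain ⟨rfl, h⟩ := h
        refine ⟨rfl, ?_⟩
        by_cases ht : t = x <;> by_cases hs : s = x
        · rw [ht, hs]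
        · rw [ht, hμx, hμ s hs] at h
          exact absurd ⟨ht, h ▸ hq1⟩ hp2
        · rw [hs, hμx, hμ t ht] at h
          exact absurd ⟨hs, h ▸ hp1⟩ hq2
        · rwa [hμ t ht, hμ s hs] at h
    omega
  have hW' : W'.card ≤ (palette (tensor K L) W').card := by
    refine hL K A hK W' ?_
    intro p hp
    obtain ⟨q, hq, rfl⟩ := Finset.mem_image.1 (Finset.mem_coe.1 hp)
    exact ⟨(hW hq).1, hμS _ (hW hq).2⟩
  have hKI : I.card ≤ (palette K I).card := by
    refine hK I fun P hP => ?_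
    exact (hW (hI P hP).1).1
  let c := palette (tensor K L) W
  let c' := palette (tensor K L) W'
  -- merging creates no color except with `L`-part that of the diagonal
  have hlost : ∀ e ∈ c' \ c, e.2 = L x x ∧ (e.1, L x y) ∈ c := by
    intro e he
    obtain ⟨he1, he2⟩ := Finset.mem_sdiff.1 he
    obtain ⟨p', hp', q', hq', rfl⟩ := mem_palette.1 he1
    obtain ⟨⟨P, s⟩, hp, rfl⟩ := Finset.mem_image.1 hp'
    obtain ⟨⟨Q, t⟩, hq, rfl⟩ := Finset.mem_image.1 hq'
    have hs := (hW hp).2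
    have ht := (hW hq).2
    have hin := mem_palette_of_mem (tensor K L) hp hq
    simp only [tensor, Prod.map_apply, id_eq] at hin he2 hs ht ⊢
    by_cases hsx : s = x <;> by_cases htx : t = x
    · subst hsx; subst htx
      rw [hμx, ← hdiag] at he2
      exact absurd hin he2
    · subst hsx
      rw [hμx, hμ t htx] at he2 ⊢
      by_cases hty : t = y
      · subst hty
        exact ⟨hdiag.symm, hin⟩
      · rw [← (htwin t (ht.resolve_left htx) hty).1] at he2
        exact absurd hin he2
    · subst htx
      rw [hμx, hμ s hsx] at he2 ⊢
      by_cases hsy : s = y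
      · subst hsy
        exact ⟨hdiag.symm, by rw [← hsymm]; exact hin⟩
      · rw [← (htwin s (hs.resolve_left hsx) hsy).2] at he2
        exact absurd hin he2
    · rw [hμ s hsx, hμ t htx] at he2
      exact absurd hin he2
  -- the colors that merging creates are matched with colors of edges between the two columns
  let twin : D → D × C := fun k => (k, L x y)
  have htw : Function.Injective twin := fun a b h => congrArg Prod.fst h
  have hdisj : Disjoint ((c' \ c).image Prod.fst) (palette K I) := by
    rw [Finset.disjoint_left]
    intro k hk hk'
    obtain ⟨e, he, rfl⟩ := Finset.mem_image.1 hk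
    obtain ⟨P, hP, Q, hQ, h⟩ := mem_palette.1 hk'
    refine (Finset.mem_sdiff.1 he).2 ?_
    have := mem_palette_of_mem (tensor K L) (hI P hP).1 (hI Q hQ).1
    simp only [tensor] at this
    rwa [h, ← (hlost e he).1] at this
  have hnot : ∀ k, twin k ∉ c' := by
    intro k hk
    obtain ⟨p, hp, q, hq, h⟩ := mem_palette.1 hk
    obtain ⟨p', hp', rfl⟩ := Finset.mem_image.1 hp
    obtain ⟨q', hq', rfl⟩ := Finset.mem_image.1 hq
    exact hnew _ (hμS _ (hW hp').2) _ (hμS _ (hW hq').2) (congrArg Prod.snd h)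
  have hsub : (c' ∩ c) ∪ (((c' \ c).image Prod.fst) ∪ palette K I).image twin ⊆ c := by
    intro e he
    rcases Finset.mem_union.1 he with he | he
    · exact (Finset.mem_inter.1 he).2
    · obtain ⟨k, hk, rfl⟩ := Finset.mem_image.1 he
      rcases Finset.mem_union.1 hk with hk | hk
      · obtain ⟨e, he', rfl⟩ := Finset.mem_image.1 hk
        exact (hlost e he').2
      · obtain ⟨P, hP, Q, hQ, rfl⟩ := mem_palette.1 hk
        exact mem_palette_of_mem (tensor K L) (hI P hP).1 (hI Q hQ).2
  have hfst : ((c' \ c).image Prod.fst).card = (c' \ c).card := by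
    refine Finset.card_image_of_injOn fun e he e' he' h => ?_
    exact Prod.ext h ((hlost e he).1.trans (hlost e' he').1.symm)
  have hdisj' : Disjoint (c' ∩ c) ((((c' \ c).image Prod.fst) ∪ palette K I).image twin) := by
    rw [Finset.disjoint_left]
    intro e he he'
    obtain ⟨k, -, rfl⟩ := Finset.mem_image.1 he'
    exact hnot k (Finset.mem_inter.1 he).1
  have hfin := Finset.card_le_card hsub
  rw [Finset.card_union_of_disjoint hdisj', Finset.card_image_of_injective _ htw,
    Finset.card_union_of_disjoint hdisj, hfst] at hfin
  have := Finset.card_inter_add_card_sdiff c' c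
  change W.card ≤ c.card
  change W'.card ≤ c'.card at hW'
  omega

open Classical in
/-- The coloring pulled back along `π`, with a color of its own on each pair inside a fiber. -/
noncomputable def blowUp (π : V → X) (K : X → X → D) (x y : V) : Option (D ⊕ Sym2 V) :=
  if x = y then none else if π x = π y then some (.inr s(x, y)) else some (.inl (K (π x) (π y)))

/-- A blow-up arises, up to refinement, by adding twins one at a time. -/
theorem stablyExpanding_blowUp {π : V → X} {K : X → X → D} (hdiag : ∀ a b, K a a = K b b)
    (S : Finset V) (hK : StablyExpanding K (π '' S)) :
    StablyExpanding (blowUp π K) (S : Set V) := by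
  classical
  induction hn : S.card generalizing S with
  | zero => exact StablyExpanding.of_subsingleton _ (by simp [Finset.card_eq_zero.1 hn])
  | succ n ih =>
    by_cases hinj : Set.InjOn π S
    · refine hK.of_refines π hinj (Set.mapsTo_image _ _) ?_
      intro x hx y hy x' hx' y' hy' h
      by_cases hxy : x = y <;> by_cases hxy' : x' = y'
      · subst hxy; subst hxy'
        exact hdiag _ _
      · simp only [blowUp, hxy, hxy', if_true, if_false] at h
        split_ifs at h
      · simp only [blowUp, hxy, hxy', if_true, if_false] at h
        split_ifs at h
      · have h1 : π x ≠ π y := fun h => hxy (hinj hx hy h)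
        have h2 : π x' ≠ π y' := fun h => hxy' (hinj hx' hy' h)
        simpa [blowUp, hxy, hxy', h1, h2] using h
    · simp only [Set.InjOn, not_forall] at hinj
      obtain ⟨x, hx, y, hy, hπ, hxy⟩ := hinj
      replace hxy : x ≠ y := hxy
      have hx' : x ∈ S := hx
      have hy' : y ∈ S.erase x := Finset.mem_erase.2 ⟨Ne.symm hxy, hy⟩
      rw [← Finset.insert_erase hx', Finset.coe_insert]
      have h0 := ih (S.erase x) (hK.mono (Set.image_mono (by simp)))
        (by rw [Finset.card_erase_of_mem hx', hn]; rfl)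
      -- a coarsening in which `x` becomes a twin of `y`
      let μ : V → V := fun u => if u = x then y else u
      have hμx : μ x = y := if_pos rfl
      have hμ : ∀ u, u ≠ x → μ u = u := fun u hu => if_neg hu
      have hπμ : ∀ u, π (μ u) = π u := by
        intro u
        by_cases hu : u = x
        · rw [hu, hμx, hπ]
        · rw [hμ u hu]
      let F : V → V → Option (D ⊕ Sym2 V) := fun u v =>
        if s(u, v) = s(x, y) then blowUp π K x y else blowUp π K (μ u) (μ v)
      have hF : ∀ a b, a ≠ x → b ≠ x → F a b = blowUp π K a b := by
        intro a b ha hb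
        have : s(a, b) ≠ s(x, y) := by simp [ha, hb]
        simp only [F, if_neg this, hμ a ha, hμ b hb]
      have hxx : s(x, x) ≠ s(x, y) := by simpa using hxy
      have hFS : StablyExpanding F (S.erase x : Finset V) := by
        refine h0.of_refines id (Set.injOn_id _) (Set.mapsTo_id _) ?_
        intro a ha b hb a' ha' b' hb' h
        rwa [hF _ _ (Finset.mem_erase.1 ha).1 (Finset.mem_erase.1 hb).1,
          hF _ _ (Finset.mem_erase.1 ha').1 (Finset.mem_erase.1 hb').1] at h
      have hFx : StablyExpanding F (insert x (S.erase x : Finset V)) := by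
        refine hFS.insert_twin (y := y) hy' (by simp) ?_ ?_ ?_ ?_
        · rw [hF y y hxy.symm hxy.symm]
          simp only [F, if_neg hxx, blowUp, if_true]
        · simp [F]
        · intro z hz hzy
          have hzx : z ≠ x := (Finset.mem_erase.1 hz).1
          have e1 : s(x, z) ≠ s(x, y) := by simpa [hxy] using hzy
          have e2 : s(z, x) ≠ s(x, y) := by rwa [Sym2.eq_swap]
          rw [hF y z hxy.symm hzx, hF z y hzx hxy.symm]
          simp only [F, if_neg e1, if_neg e2, hμx, hμ z hzx, and_self]
        · intro a ha b hb
          have hax : a ≠ x := (Finset.mem_erase.1 ha).1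
          have hbx : b ≠ x := (Finset.mem_erase.1 hb).1
          rw [hF a b hax hbx]
          simp only [F, blowUp, hxy, hπ, if_true, if_false]
          split_ifs <;> simp [hax, hbx]
      refine hFx.of_refines id (Set.injOn_id _) (Set.mapsTo_id _) ?_
      intro u _ v _ u' _ v' _ h
      simp only [id_eq, F]
      simp only [blowUp] at h
      split_ifs at h with h1 h2 h3 h4 h5 h6 h7
      · subst h1; subst h2
        have e : ∀ w, s(w, w) ≠ s(x, y) := by
          intro w hw
          simp only [Sym2.eq_iff] at hw
          rcases hw with ⟨rfl, h⟩ | ⟨rfl, h⟩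
          · exact hxy h
          · exact hxy h.symm
        simp [e, blowUp]
      · simp only [Option.some.injEq, Sum.inr.injEq] at h
        rw [h]
        rcases Sym2.eq_iff.1 h with ⟨rfl, rfl⟩ | ⟨rfl, rfl⟩
        · rfl
        · simp [blowUp, hπμ, h4, Sym2.eq_swap, eq_comm]
      · simp at h
      · simp at h
      · have e : ∀ w z, π w ≠ π z → s(w, z) ≠ s(x, y) := by
          intro w z hwz hw
          rcases Sym2.eq_iff.1 hw with ⟨rfl, rfl⟩ | ⟨rfl, rfl⟩
          · exact hwz hπ
          · exact hwz hπ.symm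
        have e' : ∀ w z, π w ≠ π z → μ w ≠ μ z := by
          intro w z hwz hw
          exact hwz (by rw [← hπμ w, hw, hπμ])
        simp only [Option.some.injEq, Sum.inl.injEq] at h
        simp [blowUp, *]

end Expanding

/-! ### Blocks, prefixes and first differences -/

section Blocks

theorem take_succ_mul (r k : ℕ) (x : List Bool) :
    x.take ((k + 1) * r) = x.take (k * r) ++ block r x k := by
  rw [Nat.succ_mul, List.take_add, block]

theorem block_take (r k i : ℕ) (x : List Bool) :
    block r (x.take (k * r)) i = if i < k then block r x i else [] := by
  unfold block
  rw [List.drop_take, List.take_take]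
  split_ifs with h
  · have : i * r + r ≤ k * r := by rw [← Nat.succ_mul]; exact Nat.mul_le_mul_right r h
    rw [min_eq_left (by omega)]
  · have : k * r ≤ i * r := Nat.mul_le_mul_right r (not_lt.1 h)
    rw [Nat.sub_eq_zero_of_le this]
    simp

theorem take_eq_take_iff {r k : ℕ} {x y : List Bool} :
    x.take (k * r) = y.take (k * r) ↔ ∀ i < k, block r x i = block r y i := by
  constructor
  · intro h i hi
    have := congrArg (fun z => block r z i) h
    simpa [block_take, hi] using this
  · intro h
    induction k with
    | zero => simp
    | succ k ih =>
      rw [take_succ_mul, take_succ_mul, ih fun i hi => h i (by omega), h k (by omega)]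

theorem exists_injOn_take {r : ℕ} (hr : 0 < r) (S : Finset (List Bool)) :
    ∃ k, Set.InjOn (fun x : List Bool => x.take (k * r)) S := by
  refine ⟨S.sup List.length, fun x hx y hy h => ?_⟩
  have key : ∀ z ∈ S, z.take (S.sup List.length * r) = z := fun z hz =>
    List.take_of_length_le ((Finset.le_sup (f := List.length) hz).trans
      (Nat.le_mul_of_pos_right _ hr))
  simpa only [key x hx, key y hy] using h

theorem exists_block_ne {r : ℕ} (hr : 0 < r) {x y : List Bool} (h : x ≠ y) :
    ∃ i, block r x i ≠ block r y i := by
  by_contra! hb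
  obtain ⟨k, hk⟩ := exists_injOn_take hr {x, y}
  exact h (hk (by simp) (by simp) (take_eq_take_iff.2 fun i _ => hb i))

theorem eta_self (r : ℕ) (x : List Bool) : eta r x x = none := by
  simp [eta]

theorem eta_eq_none_iff {r : ℕ} {x y : List Bool} : eta r x y = none ↔ x = y := by
  unfold eta
  split_ifs with h <;> simp [h]

/-- The value of `eta`, when the first difference is known to be in block `k`. -/
theorem eta_eq_some {r k : ℕ} {x y : List Bool} (h : x.take (k * r) = y.take (k * r))
    (hk : block r x k ≠ block r y k) : eta r x y = some (k, s(block r x k, block r y k)) := by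
  have hxy : x ≠ y := fun h => hk (h ▸ rfl)
  have hi : sInf {i : ℕ | block r x i ≠ block r y i} = k := by
    refine le_antisymm (Nat.sInf_le hk) (le_csInf ⟨k, hk⟩ fun i hi => ?_)
    by_contra! hik
    exact hi (take_eq_take_iff.1 h i hik)
  simp only [eta, if_neg hxy, hi]

theorem exists_first_difference {r : ℕ} (hr : 0 < r) {x y : List Bool} (h : x ≠ y) :
    ∃ k, x.take (k * r) = y.take (k * r) ∧ block r x k ≠ block r y k := by
  classical
  refine ⟨Nat.find (exists_block_ne hr h), take_eq_take_iff.2 fun i hi => ?_,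
    Nat.find_spec (exists_block_ne hr h)⟩
  simpa using Nat.find_min (exists_block_ne hr h) hi

/-- The value of `eta` on prefixes is the value on the full strings, erased if the first
difference is beyond the prefix. -/
theorem eta_take {r : ℕ} (hr : 0 < r) (k : ℕ) (x y : List Bool) :
    eta r (x.take (k * r)) (y.take (k * r)) = (eta r x y).filter fun e => e.1 < k := by
  by_cases hxy : x = y
  · simp [hxy, eta_self]
  obtain ⟨j, hj, hjb⟩ := exists_first_difference hr hxy
  rw [eta_eq_some hj hjb]
  by_cases hjk : j < k
  · have h1 : (x.take (k * r)).take (j * r) = (y.take (k * r)).take (j * r) := by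
      have : j * r ≤ k * r := Nat.mul_le_mul_right r hjk.le
      rw [List.take_take, List.take_take, min_eq_left this, hj]
    rw [eta_eq_some h1 (by simpa [block_take, hjk] using hjb)]
    simp [block_take, hjk, Option.filter]
  · have h1 : x.take (k * r) = y.take (k * r) :=
      take_eq_take_iff.2 fun i hi => take_eq_take_iff.1 hj i (by omega)
    rw [h1, eta_self]
    simp [hjk, Option.filter]

/-- The color under `eta` of two strings that first differ in block `k` determines `k` and the
unordered pair of these blocks. -/
theorem eta_eq_eta {r k : ℕ} (hr : 0 < r) {x y x' y' : List Bool}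
    (h : x.take (k * r) = y.take (k * r)) (hk : block r x k ≠ block r y k)
    (he : eta r x y = eta r x' y') :
    x'.take (k * r) = y'.take (k * r) ∧
      s(block r x k, block r y k) = s(block r x' k, block r y' k) := by
  rw [eta_eq_some h hk] at he
  have hxy : x' ≠ y' := by
    rintro rfl
    simp [eta_self] at he
  obtain ⟨j, hj, hjb⟩ := exists_first_difference hr hxy
  rw [eta_eq_some hj hjb] at he
  simp only [Option.some.injEq, Prod.mk.injEq] at he
  obtain ⟨rfl, he⟩ := he
  exact ⟨hj, he⟩

end Blocks

/-! ### The coloring `c` level by level -/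

section Tower

/-- The values of `towerColor` at level `d`. -/
def TowerColor : ℕ → Type
  | 0 => Option (ℕ × Sym2 (List Bool))
  | d + 1 => Option (ℕ × Sym2 (List Bool)) × (ℕ → TowerColor d)

/-- A recursive form of the coloring `c_d`, for strings of any length: `η_d`, together with the
colors of level `d - 1` of all pairs of corresponding `r_d`-blocks. -/
noncomputable def towerColor (r : ℕ → ℕ) : (d : ℕ) → List Bool → List Bool → TowerColor d
  | 0, x, y => eta (r 0) x y
  | d + 1, x, y => (eta (r (d + 1)) x y,
      fun i => towerColor r d (block (r (d + 1)) x i) (block (r (d + 1)) y i))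

variable {r : ℕ → ℕ}

theorem eta_eq_of_towerColor_eq {d : ℕ} {x y x' y' : List Bool}
    (h : towerColor r d x y = towerColor r d x' y') : eta (r d) x y = eta (r d) x' y' := by
  cases d with
  | zero => exact h
  | succ d => exact congrArg Prod.fst h

theorem towerColor_block_eq {d : ℕ} {x y x' y' : List Bool}
    (h : towerColor r (d + 1) x y = towerColor r (d + 1) x' y') (i : ℕ) :
    towerColor r d (block (r (d + 1)) x i) (block (r (d + 1)) y i) =
      towerColor r d (block (r (d + 1)) x' i) (block (r (d + 1)) y' i) :=
  congrFun (congrArg Prod.snd h) i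

theorem towerColor_comm (d : ℕ) (x y : List Bool) :
    towerColor r d y x = towerColor r d x y := by
  induction d generalizing x y with
  | zero => exact eta_comm _ _ _
  | succ d ih => exact Prod.ext (eta_comm _ _ _) (funext fun i => ih _ _)

theorem towerColor_self (d : ℕ) (x y : List Bool) :
    towerColor r d x x = towerColor r d y y := by
  induction d generalizing x y with
  | zero => exact (eta_self _ _).trans (eta_self _ _).symm
  | succ d ih => exact Prod.ext (by simp [towerColor, eta_self]) (funext fun i => ih _ _)

theorem eq_iff_eq_of_towerColor_eq {d : ℕ} {x y x' y' : List Bool}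
    (h : towerColor r d x y = towerColor r d x' y') : x = y ↔ x' = y' := by
  rw [← eta_eq_none_iff (r := r d), eta_eq_of_towerColor_eq h, eta_eq_none_iff]

/-- The color of two strings determines the color of their prefixes. -/
theorem towerColor_take_eq {d : ℕ} (hr : ∀ d, 0 < r d) (k : ℕ) {x y x' y' : List Bool}
    (h : towerColor r d x y = towerColor r d x' y') :
    towerColor r d (x.take (k * r d)) (y.take (k * r d)) =
      towerColor r d (x'.take (k * r d)) (y'.take (k * r d)) := by
  have h0 : eta (r d) (x.take (k * r d)) (y.take (k * r d)) =
      eta (r d) (x'.take (k * r d)) (y'.take (k * r d)) := by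
    rw [eta_take (hr d), eta_take (hr d), eta_eq_of_towerColor_eq h]
  cases d with
  | zero => exact h0
  | succ d =>
    refine Prod.ext h0 (funext fun i => ?_)
    simp only [towerColor, block_take]
    split_ifs
    · exact towerColor_block_eq h i
    · rfl

variable {V C D X : Type}

/-- A coloring that determines the color under `K` of the images, and in which the edges inside the
fibers of `π` have colors of their own, refines the blow-up. -/
theorem refines_blowUp {F : V → V → C} {π : V → X} {K : X → X → D} {S : Set V}
    (hF : ∀ ⦃x y x' y'⦄, F x y = F x' y' → (x = y ↔ x' = y'))
    (hK : ∀ ⦃a b a' b'⦄, K a b = K a' b' → (a = b ↔ a' = b'))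
    (hFK : ∀ ⦃x y x' y'⦄, F x y = F x' y' → K (π x) (π y) = K (π x') (π y'))
    (hfib : ∀ ⦃x⦄, x ∈ S → ∀ ⦃y⦄, y ∈ S → ∀ ⦃x'⦄, x' ∈ S → ∀ ⦃y'⦄, y' ∈ S →
      x ≠ y → π x = π y → F x y = F x' y' → s(x, y) = s(x', y')) :
    Refines F (blowUp π K) S := by
  intro x hx y hy x' hx' y' hy' h
  have h1 := hF h
  have h2 := hK (hFK h)
  simp only [blowUp]
  by_cases h3 : x = y
  · rw [if_pos h3, if_pos (h1.1 h3)]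
  rw [if_neg h3, if_neg (mt h1.2 h3)]
  by_cases h4 : π x = π y
  · rw [if_pos h4, if_pos (h2.1 h4), hfib hx hy hx' hy' h3 h4 h]
  · rw [if_neg h4, if_neg (mt h2.2 h4), hFK h]

/-- To prove stable expansion it is enough to pass from prefixes of `k` blocks to strings that are
determined by their first `k + 1` blocks. -/
theorem stablyExpanding_towerColor_of_step {d n : ℕ} (hr : ∀ d, 0 < r d)
    (hstep : ∀ (k : ℕ) (S : Finset (List Bool)), S.card ≤ n →
      (∀ x ∈ S, ∀ y ∈ S, x.take (k * r d) = y.take (k * r d) →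
        block (r d) x k = block (r d) y k → x = y) →
      StablyExpanding (towerColor r d) ((fun x => x.take (k * r d)) '' (S : Set (List Bool))) →
      StablyExpanding (towerColor r d) (S : Set (List Bool)))
    (S : Finset (List Bool)) (hS : S.card ≤ n) :
    StablyExpanding (towerColor r d) (S : Set (List Bool)) := by
  classical
  have key : ∀ (k : ℕ) (S : Finset (List Bool)), S.card ≤ n →
      Set.InjOn (fun x : List Bool => x.take (k * r d)) S →
      StablyExpanding (towerColor r d) (S : Set (List Bool)) := by
    intro k
    induction k with
    | zero =>
      intro S _ hinj
      exact StablyExpanding.of_subsingleton _ fun x hx y hy => hinj hx hy (by simp)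
    | succ k ih =>
      intro S hS hinj
      refine hstep k S hS ?_ ?_
      · intro x hx y hy h1 h2
        refine hinj hx hy ?_
        simp only [take_succ_mul, h1, h2]
      · rw [← Finset.coe_image]
        refine ih _ (Finset.card_image_le.trans hS) ?_
        rintro x hx y hy h
        obtain ⟨x, -, rfl⟩ := Finset.mem_image.1 (Finset.mem_coe.1 hx)
        obtain ⟨y, -, rfl⟩ := Finset.mem_image.1 (Finset.mem_coe.1 hy)
        simpa [List.take_take] using h
  obtain ⟨k, hk⟩ := exists_injOn_take (hr d) S
  exact key k S hS hk

/-- At level `d`, the coloring is stably expanding on sets of at most `d + 3` strings. The strings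
are cut after more and more blocks. If the last block takes few values, the coloring refines the
product of the colorings of the prefixes and of the last blocks. Otherwise the last block
separates the whole set, and the coloring refines a blow-up of the coloring of the prefixes. -/
theorem stablyExpanding_towerColor (hr : ∀ d, 0 < r d) (d : ℕ) (S : Finset (List Bool))
    (hS : S.card ≤ d + 3) : StablyExpanding (towerColor r d) (S : Set (List Bool)) := by
  classical
  induction d generalizing S with
  | zero =>
    refine stablyExpanding_towerColor_of_step hr (fun k S hS hsep hK => ?_) S hS
    refine (stablyExpanding_blowUp (towerColor_self 0) S hK).of_refines id (Set.injOn_id _)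
      (Set.mapsTo_id _) (refines_blowUp (fun _ _ _ _ => eq_iff_eq_of_towerColor_eq)
        (fun _ _ _ _ => eq_iff_eq_of_towerColor_eq) (fun _ _ _ _ => towerColor_take_eq hr k) ?_)
    intro x hx y hy x' hx' y' hy' hxy hπ h
    obtain ⟨hπ', hb⟩ := eta_eq_eta (hr 0) hπ (fun hb => hxy (hsep x hx y hy hπ hb))
      (eta_eq_of_towerColor_eq h)
    have hxy' : x' ≠ y' := mt (eq_iff_eq_of_towerColor_eq h).2 hxy
    by_cases hP : x.take (k * r 0) = x'.take (k * r 0)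
    · rcases Sym2.eq_iff.1 hb with ⟨h1, h2⟩ | ⟨h1, h2⟩
      · rw [hsep x hx x' hx' hP h1, hsep y hy y' hy' (hπ.symm.trans (hP.trans hπ')) h2]
      · rw [hsep x hx y' hy' (hP.trans hπ') h1, hsep y hy x' hx' (hπ.symm.trans hP) h2,
          Sym2.eq_swap]
    · -- otherwise `x`, `y`, `x'`, `y'` are four distinct strings
      have h4 : ({x, y, x', y'} : Finset (List Bool)).card = 4 := by
        have h1 : x ≠ x' := fun h => hP (h ▸ rfl)
        have h2 : x ≠ y' := fun h => hP ((h ▸ hπ'.symm : _))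
        have h3 : y ≠ x' := fun h => hP (h ▸ hπ)
        have h5 : y ≠ y' := fun h => hP (hπ.trans (h ▸ hπ'.symm))
        rw [Finset.card_insert_of_notMem, Finset.card_insert_of_notMem,
          Finset.card_pair hxy'] <;> simp [*]
      have : ({x, y, x', y'} : Finset (List Bool)) ⊆ S := by
        intro z hz
        simp only [Finset.mem_insert, Finset.mem_singleton] at hz
        rcases hz with rfl | rfl | rfl | rfl <;> assumption
      have := Finset.card_le_card this
      omega
  | succ d ih =>
    refine stablyExpanding_towerColor_of_step hr (fun k S hS hsep hK => ?_) S hS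
    by_cases hT : (S.image fun x => block (r (d + 1)) x k).card ≤ d + 3
    · refine (hK.prod (ih _ hT)).of_refines
        (fun x => (x.take (k * r (d + 1)), block (r (d + 1)) x k)) ?_ ?_ ?_
      · intro x hx y hy h
        exact hsep x hx y hy (congrArg Prod.fst h) (congrArg Prod.snd h)
      · exact fun x hx => ⟨Set.mem_image_of_mem _ hx, Finset.mem_image_of_mem _ hx⟩
      · intro x _ y _ x' _ y' _ h
        exact Prod.ext (towerColor_take_eq hr k h) (towerColor_block_eq h k)
    · have hinj : Set.InjOn (fun x => block (r (d + 1)) x k) S := by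
        refine Finset.injOn_of_card_image_eq (le_antisymm Finset.card_image_le ?_)
        omega
      refine (stablyExpanding_blowUp (towerColor_self _) S hK).of_refines id (Set.injOn_id _)
        (Set.mapsTo_id _) (refines_blowUp (fun _ _ _ _ => eq_iff_eq_of_towerColor_eq)
          (fun _ _ _ _ => eq_iff_eq_of_towerColor_eq) (fun _ _ _ _ => towerColor_take_eq hr k) ?_)
      intro x hx y hy x' hx' y' hy' hxy hπ h
      obtain ⟨-, hb⟩ := eta_eq_eta (hr _) hπ (fun hb => hxy (hsep x hx y hy hπ hb))
        (eta_eq_of_towerColor_eq h)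
      rcases Sym2.eq_iff.1 hb with ⟨h1, h2⟩ | ⟨h1, h2⟩
      · rw [hinj hx hx' h1, hinj hy hy' h2]
      · rw [hinj hx hy' h1, hinj hy hx' h2, Sym2.eq_swap]

end Tower

open SimpleGraph

/-! ### Leftover structures -/

section Leftover

variable {V C : Type} {f : TopEdgeLabeling V C}

open Classical in
/-- An edge-coloring as a function of two vertices, with the extra value `none` on the diagonal. -/
noncomputable def pairColor (f : TopEdgeLabeling V C) (x y : V) : Option C :=
  if h : x = y then none else some (f.get x y h)

theorem pairColor_self (x : V) : pairColor f x x = none := by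
  simp [pairColor]

theorem pairColor_of_ne {x y : V} (h : x ≠ y) : pairColor f x y = some (f.get x y h) := by
  simp [pairColor, h]

theorem pairColor_comm (x y : V) : pairColor f y x = pairColor f x y := by
  by_cases h : x = y
  · rw [h]
  · rw [pairColor_of_ne h, pairColor_of_ne (Ne.symm h), EdgeLabeling.get_comm]

theorem pairColor_eq_none_iff {x y : V} : pairColor f x y = none ↔ x = y := by
  by_cases h : x = y <;> simp [pairColor, h]

theorem some_mem_palette {S : Finset V} {c : C} :
    some c ∈ palette (pairColor f) S ↔ c ∈ colorsOn f S := by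
  rw [mem_palette]
  constructor
  · rintro ⟨x, hx, y, hy, h⟩
    have hxy : x ≠ y := fun e => by simp [pairColor_eq_none_iff.2 e] at h
    rw [pairColor_of_ne hxy, Option.some.injEq] at h
    exact ⟨x, hx, y, hy, hxy, h⟩
  · rintro ⟨x, hx, y, hy, hxy, h⟩
    exact ⟨x, hx, y, hy, by rw [pairColor_of_ne hxy, h]⟩

theorem none_mem_palette {S : Finset V} (hS : S.Nonempty) : none ∈ palette (pairColor f) S :=
  mem_palette.2 ⟨_, hS.choose_spec, _, hS.choose_spec, pairColor_self _⟩

theorem card_palette_pairColor {S : Finset V} (hS : S.Nonempty) :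
    (palette (pairColor f) S).card = (colorsOn f S).ncard + 1 := by
  have h : (palette (pairColor f) S : Set (Option C)) = insert none (some '' colorsOn f S) := by
    ext c
    cases c with
    | none => simp [none_mem_palette hS]
    | some c => simp [some_mem_palette]
  have hfin : (some '' colorsOn f S).Finite :=
    (Finset.finite_toSet (palette (pairColor f) S)).subset (h ▸ Set.subset_insert _ _)
  rw [← Set.ncard_coe_finset, h, Set.ncard_insert_of_notMem (by simp) hfin,
    Set.ncard_image_of_injective _ (Option.some_injective C)]

variable [DecidableEq V]

theorem HasLeftover.nonempty {S : Finset V} (h : HasLeftover f S) : S.Nonempty := by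
  cases h with
  | single v => exact Finset.singleton_nonempty v
  | join A B α hA => exact hA.mono Finset.subset_union_left

theorem mem_colorsOn_union {A B : Finset V} {α : C} (hdisj : Disjoint A B)
    (hA : A.Nonempty) (hB : B.Nonempty)
    (hcross : ∀ a ∈ A, ∀ b ∈ B, ∀ h : a ≠ b, f.get a b h = α) {c : C} :
    c ∈ colorsOn f (A ∪ B) ↔ c ∈ colorsOn f A ∨ c ∈ colorsOn f B ∨ c = α := by
  constructor
  · rintro ⟨x, hx, y, hy, hxy, rfl⟩
    rcases Finset.mem_union.1 hx with hx | hx <;> rcases Finset.mem_union.1 hy with hy | hy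
    · exact .inl ⟨x, hx, y, hy, hxy, rfl⟩
    · exact .inr (.inr (hcross x hx y hy hxy))
    · exact .inr (.inr (by rw [EdgeLabeling.get_comm]; exact hcross y hy x hx hxy.symm))
    · exact .inr (.inl ⟨x, hx, y, hy, hxy, rfl⟩)
  · rintro (⟨x, hx, y, hy, hxy, rfl⟩ | ⟨x, hx, y, hy, hxy, rfl⟩ | rfl)
    · exact ⟨x, Finset.mem_union_left _ hx, y, Finset.mem_union_left _ hy, hxy, rfl⟩
    · exact ⟨x, Finset.mem_union_right _ hx, y, Finset.mem_union_right _ hy, hxy, rfl⟩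
    · obtain ⟨a, ha⟩ := hA
      obtain ⟨b, hb⟩ := hB
      have hab : a ≠ b := fun h => Finset.disjoint_left.1 hdisj ha (h ▸ hb)
      exact ⟨a, Finset.mem_union_left _ ha, b, Finset.mem_union_right _ hb, hab,
        hcross a ha b hb hab⟩

theorem HasLeftover.card_palette {S : Finset V} (h : HasLeftover f S) :
    (palette (pairColor f) S).card = S.card := by
  classical
  induction h with
  | single v =>
    have : palette (pairColor f) {v} = {none} := by
      ext c
      simp [mem_palette, pairColor_self, eq_comm]
    simp [this]
  | join A B α hAne hBne hdisj _ _ hcolors hcross hαA hαB ihA ihB =>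
    have h1 : palette (pairColor f) (A ∪ B) =
        insert (some α) (palette (pairColor f) A ∪ palette (pairColor f) B) := by
      ext c
      cases c with
      | none =>
        simp [none_mem_palette hAne, none_mem_palette (hAne.mono Finset.subset_union_left)]
      | some c =>
        rw [some_mem_palette, mem_colorsOn_union hdisj hAne hBne hcross]
        simp only [Finset.mem_insert, Finset.mem_union, some_mem_palette, Option.some.injEq]
        tauto
    have h2 : palette (pairColor f) A ∩ palette (pairColor f) B = {none} := by
      ext c
      cases c with
      | none => simp [none_mem_palette hAne, none_mem_palette hBne]
      | some c =>
        simp only [Finset.mem_inter, some_mem_palette, Finset.mem_singleton, reduceCtorEq,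
          iff_false, not_and]
        exact fun ha hb => Set.disjoint_left.1 hcolors ha hb
    have h3 := Finset.card_union_add_card_inter (palette (pairColor f) A) (palette (pairColor f) B)
    rw [h1, Finset.card_insert_of_notMem (by simp [some_mem_palette, hαA, hαB]),
      Finset.card_union_of_disjoint hdisj]
    rw [h2, Finset.card_singleton] at h3
    omega

theorem mem_colorsOn_insert_twin {A : Finset V} {x y : V} (hxy : x ≠ y) (hyA : y ∈ A)
    (htwin : ∀ z ∈ A, z ≠ y → pairColor f x z = pairColor f y z) {c : C}
    (hc : c ∈ colorsOn f (insert x A)) : c ∈ colorsOn f A ∨ c = f.get x y hxy := by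
  have key : ∀ z ∈ A, ∀ h : x ≠ z, f.get x z h ∈ colorsOn f A ∨ f.get x z h = f.get x y hxy := by
    intro z hz h
    by_cases hzy : z = y
    · subst hzy
      exact .inr rfl
    · have := htwin z hz hzy
      rw [pairColor_of_ne h, pairColor_of_ne (Ne.symm hzy), Option.some.injEq] at this
      exact .inl ⟨y, hyA, z, hz, Ne.symm hzy, this.symm⟩
  obtain ⟨a, ha, b, hb, hab, rfl⟩ := hc
  rcases Finset.mem_insert.1 ha with rfl | ha' <;>
    rcases Finset.mem_insert.1 hb with rfl | hb'
  · exact absurd rfl hab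
  · exact key b hb' hab
  · rw [EdgeLabeling.get_comm]
    exact key a ha' hab.symm
  · exact .inl ⟨a, ha', b, hb', hab, rfl⟩

/-- A leftover structure is preserved when a vertex is doubled by an edge of a new color. -/
theorem HasLeftover.insert_twin {S : Finset V} (h : HasLeftover f S) {x y : V} (hxy : x ≠ y)
    (hy : y ∈ S) (hx : x ∉ S) (htwin : ∀ z ∈ S, z ≠ y → pairColor f x z = pairColor f y z)
    (hnew : f.get x y hxy ∉ colorsOn f S) : HasLeftover f (insert x S) := by
  induction h with
  | single v =>
    obtain rfl := Finset.mem_singleton.1 hy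
    refine .join {x} {y} (f.get x y hxy) (by simp) (by simp) (by simpa using hxy) (.single x)
      (.single y) ?_ (by simp) ?_ ?_ <;> simp [colorsOn]
  | join A B α hAne hBne hdisj hA hB hcolors hcross hαA hαB ihA ihB =>
    -- one of the two parts is enlarged; both cases are instances of the following
    have key : ∀ A B : Finset V, A.Nonempty → B.Nonempty → Disjoint A B → HasLeftover f B →
        Disjoint (colorsOn f A) (colorsOn f B) →
        (∀ a ∈ A, ∀ b ∈ B, ∀ h : a ≠ b, f.get a b h = α) →
        α ∉ colorsOn f A → α ∉ colorsOn f B → HasLeftover f (insert x A) → y ∈ A → x ∉ B →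
        (∀ z ∈ A ∪ B, z ≠ y → pairColor f x z = pairColor f y z) →
        f.get x y hxy ∉ colorsOn f (A ∪ B) → HasLeftover f (insert x A ∪ B) := by
      intro A B hAne hBne hdisj hB hcolors hcross hαA hαB hxA hyA hxB htwin hnew
      rw [mem_colorsOn_union hdisj hAne hBne hcross] at hnew
      push Not at hnew
      have hins : ∀ c ∈ colorsOn f (insert x A), c ∈ colorsOn f A ∨ c = f.get x y hxy :=
        fun c hc => mem_colorsOn_insert_twin hxy hyA
          (fun z hz => htwin z (Finset.mem_union_left _ hz)) hc
      refine .join (insert x A) B α (Finset.insert_nonempty _ _) hBne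
        (Finset.disjoint_insert_left.2 ⟨hxB, hdisj⟩) hxA hB ?_ ?_ ?_ hαB
      · refine Set.disjoint_left.2 fun c hc hcB => ?_
        rcases hins c hc with hc | rfl
        · exact Set.disjoint_left.1 hcolors hc hcB
        · exact hnew.2.1 hcB
      · intro a ha b hb hab
        rcases Finset.mem_insert.1 ha with rfl | ha
        · have hby : b ≠ y := fun h => Finset.disjoint_left.1 hdisj hyA (h ▸ hb)
          have := htwin b (Finset.mem_union_right _ hb) hby
          rw [pairColor_of_ne hab, pairColor_of_ne hby.symm, Option.some.injEq] at this
          rw [this]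
          exact hcross y hyA b hb hby.symm
        · exact hcross a ha b hb hab
      · intro hα
        rcases hins α hα with h | h
        · exact hαA h
        · exact hnew.2.2 h.symm
    have hxA : x ∉ A := fun h => hx (Finset.mem_union_left _ h)
    have hxB : x ∉ B := fun h => hx (Finset.mem_union_right _ h)
    have hnew' := hnew
    rw [mem_colorsOn_union hdisj hAne hBne hcross] at hnew'
    push Not at hnew'
    rcases Finset.mem_union.1 hy with hyA | hyB
    · rw [← Finset.insert_union]
      exact key A B hAne hBne hdisj hB hcolors hcross hαA hαB
        (ihA hyA hxA (fun z hz => htwin z (Finset.mem_union_left _ hz)) hnew'.1) hyA hxB htwin hnew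
    · rw [Finset.union_comm] at htwin hnew ⊢
      rw [← Finset.insert_union]
      exact key B A hBne hAne hdisj.symm hA hcolors.symm
        (fun b hb a ha h => by rw [EdgeLabeling.get_comm]; exact hcross a ha b hb h.symm) hαB hαA
        (ihB hyB hxB (fun z hz => htwin z (Finset.mem_union_left _ hz)) hnew'.2.1) hyB hxA htwin
        hnew

end Leftover

/-! ### Signs -/

section Signs

theorem lt_of_take_lt_take {n : ℕ} {x y : List Bool} (hl : x.length = y.length)
    (h : x.take n < y.take n) : x < y := by
  induction n generalizing x y with
  | zero => simp at h
  | succ n ih =>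
    cases x with
    | nil =>
      obtain rfl : y = [] := by simpa using hl.symm
      simp at h
    | cons a x =>
      cases y with
      | nil => simp at hl
      | cons b y =>
        simp only [List.take_succ_cons, List.cons_lt_cons_iff] at h ⊢
        exact h.imp id fun h => ⟨h.1, ih (by simpa using hl) h.2⟩

/-- If the prefixes of `x` and `y` agree, those of `x'` and `y'` agree, and the next blocks of
`x`, `x'` and of `y`, `y'` agree, then the signs tell the pair `x`, `y'` from the pair `y`, `x'`:
the prefixes order both pairs in the same way, and the next blocks appear in opposite order. -/
theorem blockSign_ne {q : ℕ} {r : ℕ → ℕ} {k : ℕ} {x y x' y' : List Bool}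
    (hl : x.length = y'.length) (hl' : y.length = x'.length)
    (hπ : x.take (k * r q) = y.take (k * r q)) (hπ' : x'.take (k * r q) = y'.take (k * r q))
    (hne : x.take (k * r q) ≠ x'.take (k * r q))
    (hb : block (r q) x k = block (r q) x' k) (hb' : block (r q) y k = block (r q) y' k)
    (hbne : block (r q) x k ≠ block (r q) y k) :
    blockSign q r k (min x y') (max x y') ≠ blockSign q r k (min y x') (max y x') := by
  rcases lt_or_gt_of_ne hne with h | h
  · have h1 : x < y' := lt_of_take_lt_take hl (by rwa [← hπ'])
    have h2 : y < x' := lt_of_take_lt_take hl' (by rwa [← hπ])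
    rw [min_eq_left h1.le, max_eq_right h1.le, min_eq_left h2.le, max_eq_right h2.le]
    simp only [blockSign, ← hb, ← hb']
    rcases lt_or_gt_of_ne hbne with h3 | h3
    · simp [h3.le, h3]
    · simp [h3.le, h3]
  · have h1 : y' < x := lt_of_take_lt_take hl.symm (by rwa [← hπ'])
    have h2 : x' < y := lt_of_take_lt_take hl'.symm (by rwa [← hπ])
    rw [min_eq_right h1.le, max_eq_left h1.le, min_eq_right h2.le, max_eq_left h2.le]
    simp only [blockSign, ← hb, ← hb']
    rcases lt_or_gt_of_ne hbne with h3 | h3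
    · simp [h3.le, h3]
    · simp [h3.le, h3]

end Signs

/-! ### Sets with few colors have a leftover structure -/

section Main

variable {V C : Type} {f : TopEdgeLabeling V C}

/-- `f` is an edge-coloring of a set of strings of equal length, named by `σ`, that is at least as
fine as `ψ_q`. -/
structure RefinesPsi (f : TopEdgeLabeling V C) (q : ℕ) (r : ℕ → ℕ) (σ : V → List Bool) :
    Prop where
  injective : Function.Injective σ
  length_eq : ∀ x y, (σ x).length = (σ y).length
  tower : ∀ x y x' y' (h : x ≠ y) (h' : x' ≠ y'), f.get x y h = f.get x' y' h' →
    towerColor r q (σ x) (σ y) = towerColor r q (σ x') (σ y')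
  sign : ∀ x y x' y' (h : x ≠ y) (h' : x' ≠ y'), f.get x y h = f.get x' y' h' →
    ∀ i, blockSign q r i (min (σ x) (σ y)) (max (σ x) (σ y)) =
      blockSign q r i (min (σ x') (σ y')) (max (σ x') (σ y'))

variable {q : ℕ} {r : ℕ → ℕ} {σ : V → List Bool}

theorem pairColor_eq_iff {x y x' y' : V} (h : pairColor f x y = pairColor f x' y') :
    x = y ↔ x' = y' := by
  rw [← pairColor_eq_none_iff (f := f), h, pairColor_eq_none_iff]

theorem RefinesPsi.towerColor_eq (hf : RefinesPsi f q r σ) {x y x' y' : V}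
    (h : pairColor f x y = pairColor f x' y') :
    towerColor r q (σ x) (σ y) = towerColor r q (σ x') (σ y') := by
  by_cases hxy : x = y
  · rw [hxy, (pairColor_eq_iff h).1 hxy]
    exact towerColor_self _ _ _
  · have hxy' : x' ≠ y' := mt (pairColor_eq_iff h).2 hxy
    rw [pairColor_of_ne hxy, pairColor_of_ne hxy', Option.some.injEq] at h
    exact hf.tower x y x' y' hxy hxy' h

/-- Suppose that the first `k + 1` blocks separate `S`. An edge `xy` of `S` whose ends have the same
first `k` blocks has a color of its own. If `x'y'` were another edge of that color, the ends would
pair up, say, so that `x`, `x'` and `y`, `y'` have the same block `k`. Then this block takes few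
values, and the product coloring of prefixes and last blocks has enough colors on `S`. It does not
distinguish the edges `xy'` and `yx'`, but the signs do. -/
theorem RefinesPsi.eq_of_pairColor_eq (hr : ∀ d, 0 < r d) (hf : RefinesPsi f (q + 1) r σ)
    {S : Finset V} (hS : S.card ≤ q + 4) (hcol : (palette (pairColor f) S).card ≤ S.card) {k : ℕ}
    (hsep : ∀ x ∈ S, ∀ y ∈ S, (σ x).take (k * r (q + 1)) = (σ y).take (k * r (q + 1)) →
      block (r (q + 1)) (σ x) k = block (r (q + 1)) (σ y) k → x = y)
    {x y x' y' : V} (hx : x ∈ S) (hy : y ∈ S) (hx' : x' ∈ S) (hy' : y' ∈ S) (hxy : x ≠ y)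
    (hπ : (σ x).take (k * r (q + 1)) = (σ y).take (k * r (q + 1)))
    (h : pairColor f x y = pairColor f x' y') : s(x, y) = s(x', y') := by
  classical
  set π : V → List Bool := fun x => (σ x).take (k * r (q + 1))
  set b : V → List Bool := fun x => block (r (q + 1)) (σ x) k
  have hbne : b x ≠ b y := fun hb => hxy (hsep x hx y hy hπ hb)
  obtain ⟨hπ', hb⟩ : π x' = π y' ∧ s(b x, b y) = s(b x', b y') :=
    eta_eq_eta (hr _) hπ hbne (eta_eq_of_towerColor_eq (hf.towerColor_eq h))
  wlog hbb : b x = b x' ∧ b y = b y' generalizing x' y'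
  · rw [Sym2.eq_swap (a := x')]
    have hb' := (Sym2.eq_iff.1 hb).resolve_left hbb
    exact this hy' hx' (h.trans (pairColor_comm _ _).symm) hπ'.symm
      (hb.trans Sym2.eq_swap) hb'
  obtain ⟨hb1, hb2⟩ := hbb
  by_cases hP : π x = π x'
  · rw [hsep x hx x' hx' hP hb1, hsep y hy y' hy' (hπ.symm.trans (hP.trans hπ')) hb2]
  exfalso
  have hxx' : x ≠ x' := fun h => hP (h ▸ rfl)
  have hT : (S.image b).card ≤ q + 3 := by
    have : (S.image b).card < S.card := by
      refine lt_of_le_of_ne Finset.card_image_le fun h => hxx' ?_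
      exact Finset.injOn_of_card_image_eq h hx hx' hb1
    omega
  have hK : StablyExpanding (towerColor r (q + 1)) (S.image π : Set (List Bool)) :=
    stablyExpanding_towerColor hr _ _ (Finset.card_image_le.trans hS)
  have hL := stablyExpanding_towerColor hr q _ hT
  -- the product coloring of prefixes and last blocks
  let H : V → V → TowerColor (q + 1) × TowerColor q := fun u v =>
    tensor (towerColor r (q + 1)) (towerColor r q) (π u, b u) (π v, b v)
  have hH : StablyExpanding H (S : Set V) := by
    refine (hK.prod hL).of_refines (fun u => (π u, b u)) ?_ ?_ fun _ _ _ _ _ _ _ _ h => h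
    · intro u hu v hv huv
      exact hsep u hu v hv (congrArg Prod.fst huv) (congrArg Prod.snd huv)
    · exact fun u hu => ⟨Finset.mem_image_of_mem _ hu, Finset.mem_image_of_mem _ hu⟩
  have href : Refines (pairColor f) H S := by
    intro u _ v _ u' _ v' _ h
    have := hf.towerColor_eq h
    exact Prod.ext (towerColor_take_eq hr k this) (towerColor_block_eq this k)
  have hcross : pairColor f x y' = pairColor f y x' := by
    refine href.symm_of_card_le (hcol.trans (hH.expanding S subset_rfl)) hx hy' hy hx' ?_
    have hπ1 : π x = π y := hπ
    simp only [H, tensor]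
    rw [hπ1, hπ', hb1, hb2, towerColor_comm q (b y')]
  have h1 : x ≠ y' := fun h => hP (by rw [hπ', h])
  have h2 : y ≠ x' := fun h => hP (hπ.trans (by rw [h]))
  rw [pairColor_of_ne h1, pairColor_of_ne h2, Option.some.injEq] at hcross
  exact blockSign_ne (hf.length_eq _ _) (hf.length_eq _ _) hπ hπ' hP hb1 hb2 hbne
    (hf.sign _ _ _ _ h1 h2 hcross k)

/-- The last block that is needed to separate the points of `S`: the blocks up to `k` separate `S`,
but those before `k` do not. -/
theorem exists_separating_block {ρ : ℕ} (hρ : 0 < ρ) (hσ : Function.Injective σ) {S : Finset V}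
    (hS : 1 < S.card) : ∃ k,
      (∀ x ∈ S, ∀ y ∈ S, (σ x).take (k * ρ) = (σ y).take (k * ρ) →
        block ρ (σ x) k = block ρ (σ y) k → x = y) ∧
      ∃ x ∈ S, ∃ y ∈ S, x ≠ y ∧ (σ x).take (k * ρ) = (σ y).take (k * ρ) := by
  classical
  have hex : ∃ k, Set.InjOn (fun x => (σ x).take (k * ρ)) S := by
    obtain ⟨k, hk⟩ := exists_injOn_take hρ (S.image σ)
    exact ⟨k, fun x hx y hy h => hσ (hk (Finset.mem_image_of_mem σ hx)
      (Finset.mem_image_of_mem σ hy) h)⟩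
  obtain ⟨x, hx, y, hy, hxy⟩ := Finset.one_lt_card.1 hS
  have hpos : Nat.find hex ≠ 0 := by
    intro h0
    have := Nat.find_spec hex
    rw [h0] at this
    exact hxy (this hx hy (by simp))
  obtain ⟨k, hk⟩ := Nat.exists_eq_succ_of_ne_zero hpos
  refine ⟨k, fun x hx y hy h1 h2 => ?_, ?_⟩
  · have := Nat.find_spec hex
    rw [hk] at this
    refine this hx hy ?_
    simp only [Nat.succ_eq_add_one, take_succ_mul, h1, h2]
  · have := Nat.find_min hex (m := k) (by omega)
    simp only [Set.InjOn, not_forall] at this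
    obtain ⟨x, hx, y, hy, h, hxy⟩ := this
    exact ⟨x, hx, y, hy, hxy, h⟩

/-- A set of at most `q + 4` vertices with fewer colors than vertices has a leftover structure.
Two vertices that differ only in the last separating block turn out to be twins, joined by an edge
whose color occurs nowhere else. -/
theorem RefinesPsi.hasLeftover [DecidableEq V] (hr : ∀ d, 0 < r d)
    (hf : RefinesPsi f (q + 1) r σ) (S : Finset V) (hne : S.Nonempty) (hS : S.card ≤ q + 4)
    (hcol : (palette (pairColor f) S).card ≤ S.card) : HasLeftover f S := by
  classical
  induction hn : S.card using Nat.strong_induction_on generalizing S with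
  | _ n ih =>
  subst hn
  obtain h1 | h1 := (Nat.one_le_iff_ne_zero.2 hne.card_pos.ne').eq_or_lt
  · obtain ⟨v, rfl⟩ := Finset.card_eq_one.1 h1.symm
    exact .single v
  obtain ⟨k, hsep, x, hx, y, hy, hxy, hπ⟩ :=
    exists_separating_block (hr (q + 1)) hf.injective h1
  set π : V → List Bool := fun x => (σ x).take (k * r (q + 1))
  have hfib : ∀ ⦃x⦄, x ∈ S → ∀ ⦃y⦄, y ∈ S → ∀ ⦃x'⦄, x' ∈ S → ∀ ⦃y'⦄, y' ∈ S →
      x ≠ y → π x = π y → pairColor f x y = pairColor f x' y' → s(x, y) = s(x', y') :=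
    fun x hx y hy x' hx' y' hy' hxy hπ h =>
      hf.eq_of_pairColor_eq hr hS hcol hsep hx hy hx' hy' hxy hπ h
  -- the colors of the edges `uv` with `π u = π v` are lost when `u` or `v` is removed
  have hlost : ∀ T ⊆ S, ∀ u ∈ S, ∀ v ∈ S, u ≠ v → π u = π v → ¬(u ∈ T ∧ v ∈ T) →
      pairColor f u v ∉ palette (pairColor f) T := by
    intro T hT u hu v hv huv hπuv hnot hmem
    obtain ⟨u', hu', v', hv', he⟩ := mem_palette.1 hmem
    rcases Sym2.eq_iff.1 (hfib hu hv (hT hu') (hT hv') huv hπuv he.symm) with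
      ⟨rfl, rfl⟩ | ⟨rfl, rfl⟩
    · exact hnot ⟨hu', hv'⟩
    · exact hnot ⟨hv', hu'⟩
  -- no third vertex agrees with `x` and `y`, as three colors would be lost with `x` and `y`
  have hthird : ∀ z ∈ S, z ≠ x → z ≠ y → π z ≠ π x := by
    intro z hz hzx hzy hπz
    let T := (S.erase x).erase y
    have hTS : T ⊆ S := (Finset.erase_subset _ _).trans (Finset.erase_subset _ _)
    have hxT : x ∉ T := by simp [T]
    have hyT : y ∉ T := by simp [T]
    have hTcard : T.card + 2 = S.card := by
      have h2 : y ∈ S.erase x := Finset.mem_erase.2 ⟨hxy.symm, hy⟩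
      rw [← Finset.card_erase_add_one hx, ← Finset.card_erase_add_one h2]
    have hl := hlost T hTS
    have hsub : insert (pairColor f x y) (insert (pairColor f x z)
        (insert (pairColor f y z) (palette (pairColor f) T))) ⊆ palette (pairColor f) S := by
      refine Finset.insert_subset (mem_palette_of_mem _ hx hy) <|
        Finset.insert_subset (mem_palette_of_mem _ hx hz) <|
        Finset.insert_subset (mem_palette_of_mem _ hy hz) (palette_mono _ hTS)
    have hc := Finset.card_le_card hsub
    have hzT : z ∈ T := Finset.mem_erase.2 ⟨hzy, Finset.mem_erase.2 ⟨hzx, hz⟩⟩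
    have hdist : ∀ u ∈ S, ∀ v ∈ S, u ≠ v → π u = π v → ∀ u' ∈ S, ∀ v' ∈ S,
        s(u, v) ≠ s(u', v') → pairColor f u v ≠ pairColor f u' v' :=
      fun u hu v hv huv hπuv u' hu' v' hv' hs h => hs (hfib hu hv hu' hv' huv hπuv h)
    have e1 : s(x, y) ≠ s(x, z) := by simp [hxy.symm, hzy.symm]
    have e2 : s(x, y) ≠ s(y, z) := by simp [hxy, hzx.symm]
    have e3 : s(x, z) ≠ s(y, z) := by simp [hxy, hzx.symm]
    have hyz : π y = π z := hπ.symm.trans hπz.symm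
    rw [Finset.card_insert_of_notMem, Finset.card_insert_of_notMem,
      Finset.card_insert_of_notMem] at hc
    · have hle : (palette (pairColor f) T).card ≤ T.card := by omega
      have := (ih T.card (by omega) T ⟨z, hzT⟩ (by omega) hle rfl).card_palette
      omega
    · exact hl y hy z hz hzy.symm hyz fun h => hyT h.1
    · simp only [Finset.mem_insert, not_or]
      exact ⟨hdist x hx z hz hzx.symm hπz.symm y hy z hz e3,
        hl x hx z hz hzx.symm hπz.symm fun h => hxT h.1⟩
    · simp only [Finset.mem_insert, not_or]
      exact ⟨hdist x hx y hy hxy hπ x hx z hz e1, hdist x hx y hy hxy hπ y hy z hz e2,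
        hl x hx y hy hxy hπ fun h => hxT h.1⟩
  -- the coloring has no more colors on `S` than the blow-up of the coloring of the prefixes
  have hblow : Refines (blowUp π (towerColor r (q + 1))) (pairColor f) S := by
    refine Refines.symm_of_card_le (refines_blowUp (fun _ _ _ _ => pairColor_eq_iff)
      (fun _ _ _ _ => eq_iff_eq_of_towerColor_eq)
      (fun _ _ _ _ h => towerColor_take_eq hr k (hf.towerColor_eq h)) hfib) (hcol.trans ?_)
    refine (stablyExpanding_blowUp (towerColor_self _) S ?_).expanding S subset_rfl
    rw [← Finset.coe_image]
    refine stablyExpanding_towerColor hr _ _ (Finset.card_image_le.trans hS)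
  have htwin : ∀ z ∈ S.erase x, z ≠ y → pairColor f x z = pairColor f y z := by
    intro z hz hzy
    obtain ⟨hzx, hz⟩ := Finset.mem_erase.1 hz
    refine hblow hx hz hy hz ?_
    have h1 := hthird z hz hzx hzy
    have hπ1 : π y = π x := hπ.symm
    simp [blowUp, hzx.symm, hzy.symm, h1.symm, hπ1]
  have hnew := hlost (S.erase x) (Finset.erase_subset _ _) x hx y hy hxy hπ (by simp)
  have hcard := Finset.card_erase_add_one hx
  have hE : HasLeftover f (S.erase x) := by
    refine ih (S.erase x).card (by omega) (S.erase x) ⟨y, Finset.mem_erase.2 ⟨hxy.symm, hy⟩⟩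
      (by omega) ?_ rfl
    have := Finset.card_le_card (Finset.insert_subset (mem_palette_of_mem (pairColor f) hx hy)
      (palette_mono (pairColor f) (Finset.erase_subset x S)))
    rw [Finset.card_insert_of_notMem hnew] at this
    omega
  rw [← Finset.insert_erase hx]
  refine hE.insert_twin hxy (Finset.mem_erase.2 ⟨hxy.symm, hy⟩) (by simp) htwin ?_
  rwa [← some_mem_palette, ← pairColor_of_ne]

end Main

/-! ### The coloring `ψ` on strings of length `β ^ (q + 1)` -/

section Psi

theorem block_drop (ρ a i : ℕ) (x : List Bool) :
    block ρ (x.drop (a * ρ)) i = block ρ x (a + i) := by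
  rw [block, block, List.drop_drop, ← Nat.add_mul]

theorem block_block (ρ c i j : ℕ) (x : List Bool) :
    block ρ (block (c * ρ) x j) i = if i < c then block ρ x (j * c + i) else [] := by
  conv_lhs => rw [block.eq_def (c * ρ), block_take, ← Nat.mul_assoc, block_drop]

theorem block_eq_nil {ρ i : ℕ} {x : List Bool} (h : x.length ≤ i * ρ) : block ρ x i = [] := by
  rw [block, List.drop_of_length_le h, List.take_nil]

/-- When the block lengths divide one another, the colors of level `d` are determined by the first
differences at all levels, since a block of a block is a block. -/
theorem towerColor_eq_of_eta_eq {r : ℕ → ℕ} (hdvd : ∀ e, r e ∣ r (e + 1)) {d : ℕ}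
    {x y x' y' : List Bool} (h1 : eta (r d) x y = eta (r d) x' y')
    (h2 : ∀ e < d, ∀ i, eta (r e) (block (r (e + 1)) x i) (block (r (e + 1)) y i) =
      eta (r e) (block (r (e + 1)) x' i) (block (r (e + 1)) y' i)) :
    towerColor r d x y = towerColor r d x' y' := by
  induction d generalizing x y x' y' with
  | zero => exact h1
  | succ d ih =>
    refine Prod.ext h1 (funext fun i => ih (h2 d (Nat.lt_succ_self d) i) fun e he j => ?_)
    obtain ⟨c, hc⟩ : r (e + 1) ∣ r (d + 1) :=
      Nat.le_induction (dvd_refl _) (fun k _ hk => hk.trans (hdvd k)) (d + 1) (by omega)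
    rw [mul_comm] at hc
    simp only [hc, block_block]
    split_ifs
    · exact h2 e (by omega) _
    · rfl

theorem blockLength_pow {q β d : ℕ} (hd : d ≤ q + 1) :
    blockLength q (fun d => β ^ d) (β ^ (q + 1)) d = β ^ d := by
  unfold blockLength
  split_ifs with h1 h2
  · simp [h1]
  · rfl
  · rw [show d = q + 1 by omega]

theorem xi_pow {q β d : ℕ} (hd : d ≤ q) {x y : List Bool} (hx : x.length = β ^ (q + 1)) :
    xi q (fun d => β ^ d) d x y =
      (List.range (numBlocks (β ^ (d + 1)) (β ^ (q + 1)))).map fun i =>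
        eta (β ^ d) (block (β ^ (d + 1)) x i) (block (β ^ (d + 1)) y i) := by
  rw [xi, hx, blockLength_pow (by omega), blockLength_pow (by omega)]

theorem le_mul_of_numBlocks_le {ρ m i : ℕ} (hρ : 0 < ρ) (h : numBlocks ρ m ≤ i) : m ≤ i * ρ := by
  rw [mul_comm]
  exact (ceilDiv_le_iff_le_mul hρ).1 h

variable {q β : ℕ} {x y x' y' : List Bool}

theorem eta_block_eq_of_psiFun_eq (hβ : 0 < β) (hx : x.length = β ^ (q + 1))
    (hy : y.length = β ^ (q + 1)) (hx' : x'.length = β ^ (q + 1)) (hy' : y'.length = β ^ (q + 1))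
    (h : psiFun q (fun d => β ^ d) x y = psiFun q (fun d => β ^ d) x' y') {d : ℕ} (hd : d ≤ q)
    (i : ℕ) : eta (β ^ d) (block (β ^ (d + 1)) x i) (block (β ^ (d + 1)) y i) =
      eta (β ^ d) (block (β ^ (d + 1)) x' i) (block (β ^ (d + 1)) y' i) := by
  by_cases hi : i < numBlocks (β ^ (d + 1)) (β ^ (q + 1))
  · have h1 := congrFun (congrArg Prod.fst h) ⟨d, Nat.lt_succ_of_le hd⟩
    simp only [psiFun, cfls] at h1
    rw [xi_pow hd hx, xi_pow hd hx'] at h1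
    exact List.map_inj_left.1 h1 i (List.mem_range.2 hi)
  · have hm := le_mul_of_numBlocks_le (pow_pos hβ _) (not_lt.1 hi)
    rw [block_eq_nil (hx.trans_le hm), block_eq_nil (hx'.trans_le hm),
      block_eq_nil (hy.trans_le hm), block_eq_nil (hy'.trans_le hm)]

theorem towerColor_eq_of_psiFun_eq (hβ : 0 < β) (hx : x.length = β ^ (q + 1))
    (hy : y.length = β ^ (q + 1)) (hx' : x'.length = β ^ (q + 1)) (hy' : y'.length = β ^ (q + 1))
    (h : psiFun q (fun d => β ^ d) x y = psiFun q (fun d => β ^ d) x' y') :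
    towerColor (fun d => β ^ d) q x y = towerColor (fun d => β ^ d) q x' y' := by
  have key := fun {d : ℕ} => eta_block_eq_of_psiFun_eq (d := d) hβ hx hy hx' hy' h
  refine towerColor_eq_of_eta_eq (fun e => pow_dvd_pow β (Nat.le_succ e)) ?_
    fun e he i => key he.le i
  have hb : ∀ z : List Bool, z.length = β ^ (q + 1) → block (β ^ (q + 1)) z 0 = z := by
    intro z hz
    rw [block, Nat.zero_mul, List.drop_zero, List.take_of_length_le hz.le]
  have := key le_rfl 0
  rwa [hb x hx, hb y hy, hb x' hx', hb y' hy'] at this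

theorem length_min_eq {m : ℕ} (hx : x.length = m) (hy : y.length = m) :
    (min x y).length = m ∧ (max x y).length = m := by
  rcases le_total x y with h | h
  · rw [min_eq_left h, max_eq_right h]
    exact ⟨hx, hy⟩
  · rw [min_eq_right h, max_eq_left h]
    exact ⟨hy, hx⟩

theorem blockSign_eq_of_psiFun_eq (hβ : 0 < β) (hx : x.length = β ^ (q + 1))
    (hy : y.length = β ^ (q + 1)) (hx' : x'.length = β ^ (q + 1)) (hy' : y'.length = β ^ (q + 1))
    (h : psiFun q (fun d => β ^ d) x y = psiFun q (fun d => β ^ d) x' y') (i : ℕ) :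
    blockSign q (fun d => β ^ d) i (min x y) (max x y) =
      blockSign q (fun d => β ^ d) i (min x' y') (max x' y') := by
  by_cases hi : i < numBlocks (β ^ q) (β ^ (q + 1))
  · have h1 := congrArg Prod.snd h
    simp only [psiFun, signs, hx, hx'] at h1
    exact List.map_inj_left.1 h1 i (List.mem_range.2 hi)
  · have hm := le_mul_of_numBlocks_le (pow_pos hβ _) (not_lt.1 hi)
    simp only [blockSign]
    rw [block_eq_nil ((length_min_eq hx hy).1.trans_le hm),
      block_eq_nil ((length_min_eq hx hy).2.trans_le hm),
      block_eq_nil ((length_min_eq hx' hy').1.trans_le hm),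
      block_eq_nil ((length_min_eq hx' hy').2.trans_le hm)]

theorem refinesPsi_pullback {V : Type} (hβ : 0 < β)
    (e : V ↪ List.Vector Bool (β ^ (q + 1))) :
    RefinesPsi ((psi q (fun d => β ^ d) (β ^ (q + 1))).pullback e) q (fun d => β ^ d)
      (fun v => (e v).toList) where
  injective := fun _ _ h => e.injective (List.Vector.toList_injective h)
  length_eq := by simp
  tower := fun _ _ _ _ _ _ h => towerColor_eq_of_psiFun_eq hβ (by simp) (by simp) (by simp)
    (by simp) h
  sign := fun _ _ _ _ _ _ h => blockSign_eq_of_psiFun_eq hβ (by simp) (by simp) (by simp)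
    (by simp) h

theorem base_spec (q n : ℕ) : 0 < base q n ∧ n ≤ 2 ^ (base q n ^ (q + 1)) := by
  refine Nat.sInf_mem (s := {β : ℕ | 0 < β ∧ n ≤ 2 ^ (β ^ (q + 1))}) ⟨n + 1, n.succ_pos, ?_⟩
  calc n ≤ n + 1 := n.le_succ
    _ ≤ (n + 1) ^ (q + 1) := Nat.le_self_pow q.succ_ne_zero _
    _ ≤ _ := Nat.lt_two_pow_self.le

theorem nonempty_embedding_vector (q n : ℕ) :
    Nonempty (Fin n ↪ List.Vector Bool (base q n ^ (q + 1))) := by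
  refine Function.Embedding.nonempty_of_card_le ?_
  simpa [card_vector] using (base_spec q n).2

end Psi

/-! ### The number of colors -/

section Counting

variable {α : Type}

open Classical in
/-- The lists of length `N` with entries in `E`. -/
noncomputable def listsOf (E : Finset α) (N : ℕ) : Finset (List α) :=
  Finset.univ.image fun g : Fin N → E => List.ofFn fun i => (g i : α)

theorem mem_listsOf {E : Finset α} {l : List α} (h : ∀ a ∈ l, a ∈ E) :
    l ∈ listsOf E l.length := by
  classical
  refine Finset.mem_image.2 ⟨fun i => ⟨l.get i, h _ (List.get_mem l i)⟩, Finset.mem_univ _, ?_⟩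
  simp

theorem card_listsOf_le (E : Finset α) (N : ℕ) : (listsOf E N).card ≤ E.card ^ N := by
  classical
  refine Finset.card_image_le.trans ?_
  simp

open Classical in
/-- The binary strings of length at most `L`. -/
noncomputable def stringsUpTo (L : ℕ) : Finset (List Bool) :=
  (Finset.range (L + 1)).biUnion fun n => listsOf Finset.univ n

theorem mem_stringsUpTo {L : ℕ} {x : List Bool} (h : x.length ≤ L) : x ∈ stringsUpTo L :=
  Finset.mem_biUnion.2 ⟨x.length, by simpa [Nat.lt_succ_iff] using h,
    mem_listsOf fun _ _ => Finset.mem_univ _⟩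

theorem card_stringsUpTo_le (L : ℕ) : (stringsUpTo L).card ≤ 2 ^ (L + 1) := by
  calc (stringsUpTo L).card ≤ ∑ n ∈ Finset.range (L + 1), 2 ^ n := by
        refine Finset.card_biUnion_le.trans (Finset.sum_le_sum fun n _ => ?_)
        simpa using card_listsOf_le (Finset.univ : Finset Bool) n
    _ ≤ 2 ^ (L + 1) := by
        rw [Nat.geomSum_eq le_rfl]
        simp

open Classical in
/-- A set that contains the values of `eta` at block length `L` on strings of length at
most `M`. -/
noncomputable def etaValues (M L : ℕ) : Finset (Option (ℕ × Sym2 (List Bool))) :=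
  insert none (((Finset.range M) ×ˢ
    ((stringsUpTo L ×ˢ stringsUpTo L).image fun p => s(p.1, p.2))).image some)

theorem eta_mem_etaValues {M L : ℕ} (hL : 0 < L) {x y : List Bool} (hx : x.length ≤ M)
    (hy : y.length ≤ M) : eta L x y ∈ etaValues M L := by
  by_cases hxy : x = y
  · rw [hxy, eta_self]
    exact Finset.mem_insert_self _ _
  obtain ⟨k, hk, hb⟩ := exists_first_difference hL hxy
  rw [eta_eq_some hk hb]
  have hkM : k < M := by
    by_contra! h
    have h' : M ≤ k * L := h.trans (Nat.le_mul_of_pos_right _ hL)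
    exact hb (by rw [block_eq_nil (hx.trans h'), block_eq_nil (hy.trans h')])
  refine Finset.mem_insert_of_mem (Finset.mem_image_of_mem _ (Finset.mem_product.2
    ⟨Finset.mem_range.2 hkM, Finset.mem_image.2 ⟨(block L x k, block L y k),
      Finset.mem_product.2 ⟨mem_stringsUpTo ?_, mem_stringsUpTo ?_⟩, rfl⟩⟩)) <;>
  exact List.length_take_le _ _

theorem card_etaValues_le {M L a : ℕ} (hM : M ≤ 2 ^ a) :
    (etaValues M L).card ≤ 2 ^ (a + 2 * L + 3) := by
  classical
  have h1 : (((Finset.range M) ×ˢ ((stringsUpTo L ×ˢ stringsUpTo L).image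
      fun p => s(p.1, p.2))).image some).card ≤ 2 ^ a * (2 ^ (L + 1) * 2 ^ (L + 1)) := by
    refine Finset.card_image_le.trans ?_
    rw [Finset.card_product, Finset.card_range]
    refine Nat.mul_le_mul hM (Finset.card_image_le.trans ?_)
    rw [Finset.card_product]
    exact Nat.mul_le_mul (card_stringsUpTo_le L) (card_stringsUpTo_le L)
  calc (etaValues M L).card ≤ 2 ^ a * (2 ^ (L + 1) * 2 ^ (L + 1)) + 1 :=
        (Finset.card_insert_le _ _).trans (Nat.add_le_add_right h1 1)
    _ ≤ 2 ^ (a + 2 * L + 2) + 2 ^ (a + 2 * L + 2) := by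
        refine Nat.add_le_add (le_of_eq ?_) Nat.one_le_two_pow
        rw [← pow_add, ← pow_add]
        congr 1
        omega
    _ = 2 ^ (a + 2 * L + 3) := by rw [← two_mul, ← pow_succ']

theorem numBlocks_mul {ρ : ℕ} (hρ : 0 < ρ) (c : ℕ) : numBlocks ρ (ρ * c) = c :=
  le_antisymm ((ceilDiv_le_iff_le_mul hρ).2 le_rfl)
    (le_of_mul_le_mul_left ((ceilDiv_le_iff_le_mul hρ).1 le_rfl) hρ)

theorem numBlocks_pow {q β d : ℕ} (hβ : 0 < β) (hd : d ≤ q) :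
    numBlocks (β ^ (d + 1)) (β ^ (q + 1)) = β ^ (q - d) := by
  have h : β ^ (q + 1) = β ^ (d + 1) * β ^ (q - d) := by
    rw [← pow_add]
    congr 1
    omega
  rw [h, numBlocks_mul (pow_pos hβ _)]

/-- A set that contains all values of `ψ_q` on strings of length `β ^ (q + 1)`. -/
noncomputable def psiValues (q β : ℕ) : Finset (PsiColor q) :=
  (Fintype.piFinset fun d : Fin (q + 1) =>
    listsOf (etaValues (β ^ (q + 1)) (β ^ (d : ℕ))) (β ^ (q - d))) ×ˢ listsOf {1, -1} β

theorem psiFun_mem_psiValues {q β : ℕ} (hβ : 0 < β) {x y : List Bool}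
    (hx : x.length = β ^ (q + 1)) (hy : y.length = β ^ (q + 1)) :
    psiFun q (fun d => β ^ d) x y ∈ psiValues q β := by
  refine Finset.mem_product.2 ⟨Fintype.mem_piFinset.2 fun d => ?_, ?_⟩
  · have hd : (d : ℕ) ≤ q := Nat.lt_succ_iff.1 d.2
    simp only [psiFun, cfls]
    rw [xi_pow hd hx, numBlocks_pow hβ hd]
    convert mem_listsOf _ using 2
    · simp
    · intro a ha
      obtain ⟨i, -, rfl⟩ := List.mem_map.1 ha
      refine eta_mem_etaValues (pow_pos hβ _) ?_ ?_
      · rw [← hx]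
        exact (List.length_take_le' _ _).trans (by simp)
      · rw [← hy]
        exact (List.length_take_le' _ _).trans (by simp)
  · have h1 : numBlocks (β ^ q) (β ^ (q + 1)) = β := numBlocks_mul (pow_pos hβ _) β
    simp only [psiFun, signs]
    rw [hx, h1]
    convert mem_listsOf _ using 2
    · simp
    · intro a ha
      obtain ⟨i, -, rfl⟩ := List.mem_map.1 ha
      unfold blockSign
      split_ifs <;> simp

theorem card_psiValues_le {q β l : ℕ} (hq : 1 ≤ q) (hβ : 0 < β) (hl : β ≤ 2 ^ l) :
    (psiValues q β).card ≤ 2 ^ (β ^ q * ((q + 1) * (5 + (q + 1) * l) + 1)) := by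
  have h1 : ∀ d : Fin (q + 1), (listsOf (etaValues (β ^ (q + 1)) (β ^ (d : ℕ)))
      (β ^ (q - d))).card ≤ 2 ^ (β ^ q * (5 + (q + 1) * l)) := by
    intro d
    have hd : (d : ℕ) ≤ q := Nat.lt_succ_iff.1 d.2
    have hM : β ^ (q + 1) ≤ 2 ^ ((q + 1) * l) := by
      rw [mul_comm, pow_mul]
      exact Nat.pow_le_pow_left hl _
    calc _ ≤ _ := card_listsOf_le _ _
      _ ≤ (2 ^ ((q + 1) * l + 2 * β ^ (d : ℕ) + 3)) ^ β ^ (q - d) :=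
        Nat.pow_le_pow_left (card_etaValues_le hM) _
      _ = 2 ^ (((q + 1) * l + 2 * β ^ (d : ℕ) + 3) * β ^ (q - d)) := (pow_mul _ _ _).symm
      _ ≤ _ := by
        refine Nat.pow_le_pow_right two_pos ?_
        have e1 : β ^ (d : ℕ) * β ^ (q - d) = β ^ q := by
          rw [← pow_add]
          congr 1
          omega
        have e2 : β ^ (q - d) ≤ β ^ q := Nat.pow_le_pow_right hβ (Nat.sub_le _ _)
        calc ((q + 1) * l + 2 * β ^ (d : ℕ) + 3) * β ^ (q - d)
            = ((q + 1) * l + 3) * β ^ (q - d) + 2 * (β ^ (d : ℕ) * β ^ (q - d)) := by ring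
          _ ≤ ((q + 1) * l + 3) * β ^ q + 2 * β ^ q := by
              rw [e1]
              exact Nat.add_le_add_right (Nat.mul_le_mul_left _ e2) _
          _ = _ := by ring
  calc (psiValues q β).card
      ≤ (∏ _d : Fin (q + 1), 2 ^ (β ^ q * (5 + (q + 1) * l))) * 2 ^ β := by
        rw [psiValues, Finset.card_product, Fintype.card_piFinset]
        refine Nat.mul_le_mul (Finset.prod_le_prod' fun d _ => h1 d) ?_
        exact card_listsOf_le _ _
    _ = 2 ^ (β ^ q * (5 + (q + 1) * l) * (q + 1) + β) := by
        rw [Finset.prod_const, Finset.card_univ, Fintype.card_fin, ← pow_mul, ← pow_add]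
    _ ≤ _ := by
        refine Nat.pow_le_pow_right two_pos ?_
        have : β ≤ β ^ q := Nat.le_self_pow (by omega) β
        calc _ ≤ β ^ q * (5 + (q + 1) * l) * (q + 1) + β ^ q := Nat.add_le_add_left this _
          _ = _ := by ring

theorem numColors_le_card_psiValues {V : Type} {q β : ℕ} (hβ : 0 < β)
    (e : V ↪ List.Vector Bool (β ^ (q + 1))) :
    numColors ((psi q (fun d => β ^ d) (β ^ (q + 1))).pullback e) ≤ (psiValues q β).card := by
  rw [← Set.ncard_coe_finset]
  refine Set.ncard_le_ncard ?_ (Finset.finite_toSet _)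
  rintro _ ⟨⟨z, hz⟩, rfl⟩
  induction z using Sym2.inductionOn with
  | hf u v => exact psiFun_mem_psiValues hβ (by simp) (by simp)

theorem numColors_eq_zero {V C : Type} [Subsingleton V] (f : TopEdgeLabeling V C) :
    numColors f = 0 := by
  have h : Set.range f = ∅ := by
    refine Set.eq_empty_of_forall_notMem ?_
    rintro _ ⟨⟨z, hz⟩, -⟩
    induction z using Sym2.inductionOn with
    | hf u v => exact hz (Subsingleton.elim u v)
  exact (congrArg Set.ncard h).trans (Set.ncard_empty _)

theorem le_two_pow_two_mul_sqrt (β : ℕ) : β ≤ 2 ^ (2 * Nat.sqrt β) := by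
  calc β ≤ (Nat.sqrt β + 1) ^ 2 := (Nat.lt_succ_sqrt' β).le
    _ ≤ (2 ^ Nat.sqrt β) ^ 2 := Nat.pow_le_pow_left Nat.lt_two_pow_self _
    _ = _ := by rw [← pow_mul, mul_comm]

theorem tendsto_base (q : ℕ) : Filter.Tendsto (base q) Filter.atTop Filter.atTop := by
  refine Filter.tendsto_atTop.2 fun b => ?_
  filter_upwards [Filter.eventually_gt_atTop (2 ^ (b ^ (q + 1)))] with n hn
  by_contra! h
  refine absurd ((base_spec q n).2.trans ?_) (not_le.2 hn)
  exact Nat.pow_le_pow_right two_pos (Nat.pow_le_pow_left h.le _)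

theorem two_pow_lt_of_one_lt_base {q n : ℕ} (h : 1 < base q n) :
    2 ^ ((base q n - 1) ^ (q + 1)) < n := by
  by_contra! hn
  have : base q n ≤ base q n - 1 := Nat.sInf_le ⟨by omega, hn⟩
  omega

/-- With `β = base q n`, the logarithm of the number of colors is `O(β ^ q * √β)`, whereas `log n`
is at least of order `β ^ (q + 1)`. -/
theorem log_card_psiValues_le {q n : ℕ} (hq : 1 ≤ q) (hβ : 1 < base q n) :
    Real.log (psiValues q (base q n)).card / Real.log n ≤
      2 ^ q * ((q + 1) * (5 + 2 * (q + 1)) + 1) / (√(base q n : ℝ) - 1) := by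
  set β := base q n
  set s := √(β : ℝ) with hs
  have hβ' : (2 : ℝ) ≤ β := by exact_mod_cast hβ
  have hss : s * s = β := Real.mul_self_sqrt (by linarith)
  have hs1 : 1 < s := by
    rw [hs, Real.lt_sqrt (by norm_num)]
    linarith
  have hlog2 : 0 < Real.log 2 := Real.log_pos (by norm_num)
  have hn : ((β : ℝ) - 1) ^ (q + 1) * Real.log 2 ≤ Real.log n := by
    have h1 : ((2 ^ ((β - 1) ^ (q + 1)) : ℕ) : ℝ) ≤ n := by
      exact_mod_cast (two_pow_lt_of_one_lt_base hβ).le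
    have h2 := Real.log_le_log (by positivity) h1
    rw [Nat.cast_pow, Real.log_pow] at h2
    simpa [Nat.cast_sub hβ.le] using h2
  have hsqrt : (Nat.sqrt β : ℝ) ≤ s := Real.nat_sqrt_le_real_sqrt
  have hcard : Real.log (psiValues q β).card ≤
      (β : ℝ) ^ q * ((q + 1) * (5 + (q + 1) * (2 * s)) + 1) * Real.log 2 := by
    obtain h0 | h0 := Nat.eq_zero_or_pos (psiValues q β).card
    · rw [h0]
      simp only [Nat.cast_zero, Real.log_zero]
      positivity
    have h1 : ((psiValues q β).card : ℝ) ≤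
        ((2 ^ (β ^ q * ((q + 1) * (5 + (q + 1) * (2 * Nat.sqrt β)) + 1)) : ℕ) : ℝ) := by
      exact_mod_cast card_psiValues_le hq (by omega) (le_two_pow_two_mul_sqrt β)
    have h2 := Real.log_le_log (by exact_mod_cast h0) h1
    rw [Nat.cast_pow, Real.log_pow] at h2
    refine h2.trans ?_
    push_cast
    gcongr
  have hden : 0 < ((β : ℝ) - 1) ^ (q + 1) * Real.log 2 := by
    have : (0 : ℝ) < β - 1 := by linarith
    positivity
  have hpow : (β : ℝ) ^ q ≤ 2 ^ q * ((β : ℝ) - 1) ^ q := by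
    rw [← mul_pow]
    exact pow_le_pow_left₀ (by linarith) (by linarith) q
  have hK : ((q : ℝ) + 1) * (5 + (q + 1) * (2 * s)) + 1 ≤
      ((q + 1) * (5 + 2 * (q + 1)) + 1) * (s + 1) := by
    have hq0 : (0 : ℝ) ≤ q := Nat.cast_nonneg q
    nlinarith [mul_nonneg hq0 hq0]
  rw [div_le_div_iff₀ (hden.trans_le hn) (by linarith)]
  calc Real.log (psiValues q β).card * (s - 1)
      ≤ (2 ^ q * ((β : ℝ) - 1) ^ q * (((q + 1) * (5 + 2 * (q + 1)) + 1) * (s + 1)) *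
          Real.log 2) * (s - 1) := by
        have : (0 : ℝ) ≤ β - 1 := by linarith
        refine mul_le_mul_of_nonneg_right (hcard.trans ?_) (by linarith)
        gcongr
    _ = 2 ^ q * ((q + 1) * (5 + 2 * (q + 1)) + 1) * (((β : ℝ) - 1) ^ q * (s * s - 1) *
          Real.log 2) := by ring
    _ = 2 ^ q * ((q + 1) * (5 + 2 * (q + 1)) + 1) * (((β : ℝ) - 1) ^ (q + 1) * Real.log 2) := by
        rw [hss, pow_succ]
    _ ≤ _ := by gcongr

/-- The number of colors is `n ^ o(1)`. -/
theorem exists_numColors_le_rpow {q : ℕ} (hq : 1 ≤ q) (f : ∀ n : ℕ, TopEdgeLabeling (Fin n)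
      (PsiColor q)) (hf : ∀ n : ℕ, numColors (f n) ≤ (psiValues q (base q n)).card) :
    ∃ o : ℕ → ℝ, Filter.Tendsto o Filter.atTop (nhds 0) ∧
      ∀ n : ℕ, (numColors (f n) : ℝ) ≤ (n : ℝ) ^ o n := by
  refine ⟨fun n => Real.log (psiValues q (base q n)).card / Real.log n, ?_, fun n => ?_⟩
  · have hlim : Filter.Tendsto (fun n => (2 : ℝ) ^ q * ((q + 1) * (5 + 2 * (q + 1)) + 1) /
        (√(base q n : ℝ) - 1)) Filter.atTop (nhds 0) := by
      refine Filter.Tendsto.const_div_atTop (Filter.tendsto_atTop_add_const_right _ _ ?_) _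
      exact Real.tendsto_sqrt_atTop.comp (tendsto_natCast_atTop_atTop.comp (tendsto_base q))
    refine tendsto_of_tendsto_of_tendsto_of_le_of_le' tendsto_const_nhds hlim ?_ ?_
    · exact .of_forall fun n => div_nonneg (Real.log_natCast_nonneg _) (Real.log_natCast_nonneg _)
    · filter_upwards [(tendsto_base q).eventually_gt_atTop 1] with n hn
      exact log_card_psiValues_le hq hn
  · obtain hn | hn := le_or_gt n 1
    · have : Subsingleton (Fin n) := Fin.subsingleton_iff_le_one.2 hn
      rw [numColors_eq_zero]
      simpa using Real.rpow_nonneg (Nat.cast_nonneg n) _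
    · obtain h0 | h0 := Nat.eq_zero_or_pos (numColors (f n))
      · rw [h0]
        simpa using Real.rpow_nonneg (Nat.cast_nonneg n) _
      · have hn0 : (0 : ℝ) < n := by exact_mod_cast (by omega : 0 < n)
        have hlog : Real.log n ≠ 0 := (Real.log_pos (by exact_mod_cast hn)).ne'
        have hpos : (0 : ℝ) < (psiValues q (base q n)).card := by
          exact_mod_cast h0.trans_le (hf n)
        rw [Real.rpow_def_of_pos hn0, mul_div_cancel₀ _ hlog, Real.exp_log hpos]
        exact_mod_cast hf n

end Counting

end ErdosGyarfas

theorem theorem1 (p : ℕ) (hp : 3 ≤ p) :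
    ∃ f : ∀ n : ℕ, SimpleGraph.TopEdgeLabeling (Fin n) (ErdosGyarfas.PsiColor (max (p - 3) 1)),
      -- `f n` is the coloring `ψ = c × Δ`, transported to `K_n` by naming its vertices by strings
      (∀ n : ℕ, ∃ e : Fin n ↪
          List.Vector Bool (ErdosGyarfas.base (max (p - 3) 1) n ^ (max (p - 3) 1 + 1)),
        f n = (ErdosGyarfas.psiFor (max (p - 3) 1) n).pullback e) ∧
      -- the number of colors is `n ^ o(1)`
      (∃ o : ℕ → ℝ, Filter.Tendsto o Filter.atTop (nhds 0) ∧
        ∀ n : ℕ, (ErdosGyarfas.numColors (f n) : ℝ) ≤ (n : ℝ) ^ o n) ∧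
      -- every `p`-clique contains at least `p - 1` colors
      (∀ n : ℕ, ErdosGyarfas.IsPQColoring (f n) p (p - 1)) ∧
      -- the `p`-cliques with exactly `p - 1` colors are those with a leftover structure
      (∀ (n : ℕ) (S : Finset (Fin n)), S.card = p →
        ((ErdosGyarfas.colorsOn (f n) S).ncard = p - 1 ↔ ErdosGyarfas.HasLeftover (f n) S)) := by
  obtain ⟨q, hq⟩ : ∃ q, max (p - 3) 1 = q + 1 := ⟨max (p - 3) 1 - 1, by omega⟩
  have hpq : p ≤ q + 4 := by omega
  rw [hq]
  have e := fun n => (ErdosGyarfas.nonempty_embedding_vector (q + 1) n).some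
  have hβ := fun n => (ErdosGyarfas.base_spec (q + 1) n).1
  have href := fun n => ErdosGyarfas.refinesPsi_pullback (hβ n) (e n)
  have hfew : ∀ (n : ℕ) (S : Finset (Fin n)), S.card = p →
      (ErdosGyarfas.colorsOn ((ErdosGyarfas.psiFor (q + 1) n).pullback (e n)) S).ncard ≤ p - 1 →
      ErdosGyarfas.HasLeftover ((ErdosGyarfas.psiFor (q + 1) n).pullback (e n)) S := by
    intro n S hS hc
    have hne : S.Nonempty := Finset.card_pos.1 (by omega)
    refine (href n).hasLeftover (fun d => pow_pos (hβ n) d) S hne (by omega) ?_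
    rw [ErdosGyarfas.card_palette_pairColor hne]
    exact (Nat.add_le_add_right hc 1).trans (by omega)
  have hcount : ∀ (n : ℕ) (S : Finset (Fin n)), S.card = p →
      ErdosGyarfas.HasLeftover ((ErdosGyarfas.psiFor (q + 1) n).pullback (e n)) S →
      (ErdosGyarfas.colorsOn ((ErdosGyarfas.psiFor (q + 1) n).pullback (e n)) S).ncard
        = p - 1 := by
    intro n S hS hL
    have h1 := hL.card_palette
    rw [ErdosGyarfas.card_palette_pairColor hL.nonempty] at h1
    omega
  refine ⟨fun n => (ErdosGyarfas.psiFor (q + 1) n).pullback (e n), fun n => ⟨e n, rfl⟩,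
    ErdosGyarfas.exists_numColors_le_rpow (by omega) _ fun n =>
      ErdosGyarfas.numColors_le_card_psiValues (hβ n) (e n), fun n S hS => ?_,
    fun n S hS => ⟨fun h => hfew n S hS h.le, hcount n S hS⟩⟩
  by_contra! hlt
  exact hlt.ne (hcount n S hS (hfew n S hS hlt.le))
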